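/- An NFA over a finite alphabet $\Sigma$ has a finite state set, a set of initial states, a set of final states and a transition function $Q\times\Sigma\to 2^Q$. A regular transition system (RTS) is a triple $\mathcal R=(\Sigma,\mathcal I,\mathcal T)$, where $\Sigma$ is a finite alphabet, $\mathcal I$ is an NFA over $\Sigma$ with state set $Q_I$, and $\mathcal T$ is an NFA over $\Sigma\times\Sigma$ with state set $Q_T$; put $n_T=|Q_T|$. Words over $\Sigma$ are called configurations; those in $L(\mathcal I)$ are initial. Write $w\leadsto u$ if $|w|=|u|$ and $\mathcal T$ accepts $(w[1],u[1])\cdots(w[\ell],u[\ell])$, where $\ell=|w|$. For $\ell\ge 0$, a $1$-formula of length $\ell$ is either $\mathit{true}$ or one clause, i.e. a finite (possibly empty) disjunction of atomic propositions $q_{j:\ell}$ with $q\in\Sigma$ and $1\le j\le\ell$. A configuration $w$ satisfies it if $|w|\neq\ell$, or if $|w|=\ell$ and the formula is true when $q_{j:\ell}$ is read as "$w[j]=q$" (the empty clause being false). A formula is inductive if $w\leadsto u$ and $w\models\varphi$ imply $u\models\varphi$. Let $\mathrm{Ind}_1$ be the set of configurations $w$ for which there is an initial configuration $u$ such that every inductive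 $1$-formula (of any length $\ell$) satisfied by $u$ is also satisfied by $w$. **Theorem.** For every RTS $\mathcal R=(\Sigma,\mathcal I,\mathcal T)$ there is an NFA $\mathcal A_1$ over $\Sigma$ such that 1. $L(\mathcal A_1)=\mathrm{Ind}_1$; 2. the state set of $\mathcal A_1$ is $(Q_T\cup\{\square\})^{n_T}\times(2^{Q_T}\times 2^{Q_T})\times\{0,1\}\times Q_I$, which has $(n_T+1)^{n_T}\cdot 2^{n_T}\cdot 2^{n_T}\cdot 2\cdot|Q_I|\le 2^{(n_T+1)^2+|Q_I|}$ elements; 3. the transition relation of $\mathcal A_1$ is decidable in polynomial time, uniformly in $\mathcal R$: there are a single algorithm and a single polynomial $p$ such that, for every RTS $\mathcal R$, all states $q,q'$ of $\mathcal A_1$ and every $a\in\Sigma$, the algorithm, given (an explicit encoding of) $\mathcal R,q,a,q'$ as input, decides within $p(N)$ steps whether $(q,a,q')$ is a transition of $\mathcal A_1$, where $N$ is the size of the input. -/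

import Mathlib

namespace RegularMC

/-! ### Regular transition systems -/

/-- A regular transition system over the alphabet `α`: an NFA `initial` over `α`, with states `QI`,
recognizing the initial configurations, and a length-preserving transducer (an NFA over `α × α`),
with states `QT`, recognizing the transitions. -/
structure RTS (α QI QT : Type*) where
  initial : NFA α QI
  transducer : NFA (α × α) QT

variable {α QI QT : Type*}

/-- `R.Trans w u`: the pair of configurations `(w, u)`, written as a word of pairs of letters, is
accepted by the transducer. In particular `w` and `u` have the same length. -/
def RTS.Trans (R : RTS α QI QT) (w u : List α) : Prop :=
  ∃ x : List (α × α), x ∈ R.transducer.accepts ∧ x.map Prod.fst = w ∧ x.map Prod.snd = u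

/-- A clause over the atomic propositions of length `l`: a finite disjunction of atomic propositions
`(q, j)`, meaning "the letter at position `j` is `q`". Positions are counted from `0`.
The empty clause is the constant `false`. -/
abbrev Clause (α : Type*) (l : ℕ) := Finset (α × Fin l)

/-- A (positive, CNF) formula over the atomic propositions of length `l`: a finite conjunction of
clauses. The empty conjunction is the constant `true`. -/
abbrev Formula (α : Type*) (l : ℕ) := List (Clause α l)

/-- Satisfaction. A formula over the atomic propositions of length `l` is satisfied by all
configurations of a length other than `l`, and by the configurations of length `l` that satisfy
each of its clauses. -/
def Formula.Sat {l : ℕ} (φ : Formula α l) (w : List α) : Prop :=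
  w.length ≠ l ∨ ∀ c ∈ φ, ∃ p ∈ c, w[(p.2 : ℕ)]? = some p.1

/-- A formula is inductive if the set of its models is closed under transitions. -/
def RTS.InductiveFormula (R : RTS α QI QT) {l : ℕ} (φ : Formula α l) : Prop :=
  ∀ w u : List α, R.Trans w u → φ.Sat w → φ.Sat u

/-- `w` is `b`-potentially-reachable from `u`: every inductive formula with at most `b` clauses
(over the atomic propositions of any length) satisfied by `u` is satisfied by `w`. -/
def RTS.PotReach (R : RTS α QI QT) (b : ℕ) (u w : List α) : Prop :=
  ∀ (l : ℕ) (φ : Formula α l), φ.length ≤ b → R.InductiveFormula φ → φ.Sat u → φ.Sat w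

/-- `Ind_b`: the configurations that are `b`-potentially-reachable from an initial one. -/
def RTS.Ind (R : RTS α QI QT) (b : ℕ) : Language α :=
  {w | ∃ u ∈ R.initial.accepts, R.PotReach b u w}

/-- The state set `(Q_T ∪ {□})^{n_T} × (2^{Q_T} × 2^{Q_T}) × {0,1} × Q_I`, where `n_T = |Q_T|` and
`□` is `none`. -/
abbrev SepState (QI QT : Type*) [Fintype QT] :=
  (Fin (Fintype.card QT) → Option QT) × (Finset QT × Finset QT) × Bool × QI

/-! ### Algorithms: while-programs over binary trees, with a step count

This is the standard WHILE language on trees (LISP-like data). An elementary operation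
(read a variable, `nil`, `cons`, head, tail, test for `nil`) moves a bounded number of pointers and
costs one step; polynomial time in this model is the usual polynomial time of Turing machines. -/

/-- Binary trees: the values that programs compute with. -/
inductive Data : Type
  | nil : Data
  | cons (l r : Data) : Data

namespace Data

/-- Number of nodes (inner nodes and leaves) of a tree. -/
def size : Data → ℕ
  | nil => 1
  | cons l r => l.size + r.size + 1

/-- First component (`nil` for `nil`). -/
def hd : Data → Data
  | nil => nil
  | cons l _ => l

/-- Second component (`nil` for `nil`). -/
def tl : Data → Data
  | nil => nil
  | cons _ r => r

end Data

/-- Expressions. Variables are numbered. -/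
inductive Expr : Type
  | var (i : ℕ) : Expr
  | nil : Expr
  | cons (e f : Expr) : Expr
  | hd (e : Expr) : Expr
  | tl (e : Expr) : Expr

/-- A store assigns a value to each variable. -/
abbrev Store := ℕ → Data

namespace Expr

/-- Value of an expression. -/
def eval (s : Store) : Expr → Data
  | var i => s i
  | nil => Data.nil
  | cons e f => Data.cons (e.eval s) (f.eval s)
  | hd e => (e.eval s).hd
  | tl e => (e.eval s).tl

/-- Number of steps that it takes to evaluate an expression: one per operation. -/
def cost : Expr → ℕ
  | var _ => 1
  | nil => 1
  | cons e f => e.cost + f.cost + 1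
  | hd e => e.cost + 1
  | tl e => e.cost + 1

end Expr

/-- Programs: assignment, sequence, conditional, while loop. `nil` counts as false, any other
value as true. -/
inductive Prog : Type
  | assign (x : ℕ) (e : Expr) : Prog
  | seq (c d : Prog) : Prog
  | cond (e : Expr) (c d : Prog) : Prog
  | loop (e : Expr) (c : Prog) : Prog

/-- `Exec c s s' t`: started in the store `s`, the program `c` halts after exactly `t` steps, in the
store `s'`. -/
inductive Exec : Prog → Store → Store → ℕ → Prop
  | assign (x : ℕ) (e : Expr) (s : Store) :
      Exec (.assign x e) s (Function.update s x (e.eval s)) (e.cost + 1)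
  | seq {c d : Prog} {s s' s'' : Store} {t t' : ℕ} :
      Exec c s s' t → Exec d s' s'' t' → Exec (.seq c d) s s'' (t + t' + 1)
  | condTrue {e : Expr} {c d : Prog} {s s' : Store} {t : ℕ} :
      e.eval s ≠ Data.nil → Exec c s s' t → Exec (.cond e c d) s s' (e.cost + t + 1)
  | condFalse {e : Expr} {c d : Prog} {s s' : Store} {t : ℕ} :
      e.eval s = Data.nil → Exec d s s' t → Exec (.cond e c d) s s' (e.cost + t + 1)
  | loopTrue {e : Expr} {c : Prog} {s s' s'' : Store} {t t' : ℕ} :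
      e.eval s ≠ Data.nil → Exec c s s' t → Exec (.loop e c) s' s'' t' →
      Exec (.loop e c) s s'' (e.cost + t + t' + 1)
  | loopFalse {e : Expr} {c : Prog} {s : Store} :
      e.eval s = Data.nil → Exec (.loop e c) s s (e.cost + 1)

/-- The store in which variable `0` holds the input and all other variables are `nil`. -/
def inputStore (d : Data) : Store := fun i => if i = 0 then d else Data.nil

/-- `AnswersWithin M d b P`: on input `d`, the program `M` halts after at most `b` steps, and its
answer (the final value of variable `0`, read as a truth value) is yes if and only if `P`. -/
def AnswersWithin (M : Prog) (d : Data) (b : ℕ) (P : Prop) : Prop :=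
  ∃ (s : Store) (t : ℕ), Exec M (inputStore d) s t ∧ t ≤ b ∧ (s 0 ≠ Data.nil ↔ P)

/-! ### Encoding of the inputs as trees -/

namespace Data

/-- A list of trees, as a tree. -/
def ofList : List Data → Data
  | [] => nil
  | x :: xs => cons x (ofList xs)

/-- A natural number, in unary. -/
def ofNat : ℕ → Data
  | 0 => nil
  | n + 1 => cons nil (ofNat n)

def ofBool : Bool → Data
  | false => nil
  | true => cons nil nil

def ofOption : Option Data → Data
  | none => nil
  | some x => cons x nil

end Data

/-- An element of a finite type, by its number in the enumeration `e`. -/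
def encElem {β : Type*} {n : ℕ} (e : β ≃ Fin n) (x : β) : Data := Data.ofNat (e x)

open Classical in
/-- A subset of a finite type: the list of (the numbers of) its elements, in the order of the
enumeration `e`. -/
noncomputable def encSet {β : Type*} {n : ℕ} (e : β ≃ Fin n) (S : Set β) : Data :=
  Data.ofList ((((List.finRange n).map e.symm).filter (fun x => decide (x ∈ S))).map (encElem e))

open Classical in
/-- An NFA over `α`: the number of its states, the initial states, the final states, and the list of
its transitions `(q, a, q')`. -/
noncomputable def encNFA {σ : Type*} {k n : ℕ} (eα : α ≃ Fin k) (e : σ ≃ Fin n)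
    (A : NFA α σ) : Data :=
  Data.ofList [Data.ofNat n, encSet e A.start, encSet e A.accept,
    Data.ofList
      (((((List.finRange n).map e.symm) ×ˢ ((List.finRange k).map eα.symm) ×ˢ
          ((List.finRange n).map e.symm)).filter
        (fun x => decide (x.2.2 ∈ A.step x.1 x.2.1))).map
        (fun x => Data.ofList [encElem e x.1, encElem eα x.2.1, encElem e x.2.2]))]

open Classical in
/-- A transducer over `α × α`: as for an NFA, a transition being listed as `(q, a, b, q')`. -/
noncomputable def encTransducer {σ : Type*} {k n : ℕ} (eα : α ≃ Fin k) (e : σ ≃ Fin n)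
    (T : NFA (α × α) σ) : Data :=
  Data.ofList [Data.ofNat n, encSet e T.start, encSet e T.accept,
    Data.ofList
      (((((List.finRange n).map e.symm) ×ˢ ((List.finRange k).map eα.symm) ×ˢ
          ((List.finRange k).map eα.symm) ×ˢ ((List.finRange n).map e.symm)).filter
        (fun x => decide (x.2.2.2 ∈ T.step x.1 (x.2.1, x.2.2.1)))).map
        (fun x => Data.ofList
          [encElem e x.1, encElem eα x.2.1, encElem eα x.2.2.1, encElem e x.2.2.2]))]

/-- An RTS: the number of letters, the initial NFA, and the transducer. -/
noncomputable def encRTS {k m n : ℕ} (eα : α ≃ Fin k) (eI : QI ≃ Fin m) (eT : QT ≃ Fin n)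
    (R : RTS α QI QT) : Data :=
  Data.ofList [Data.ofNat k, encNFA eα eI R.initial, encTransducer eα eT R.transducer]

/-- A tuple in `(Q_T ∪ {□})^{n_T} × (2^{Q_T} × 2^{Q_T}) × {0,1} × Q_I`. -/
noncomputable def encState [Fintype QT] {m n : ℕ} (eI : QI ≃ Fin m) (eT : QT ≃ Fin n)
    (q : SepState QI QT) : Data :=
  Data.ofList
    [Data.ofList (List.ofFn fun i => Data.ofOption ((q.1 i).map (encElem eT))),
      encSet eT (q.2.1.1 : Set QT), encSet eT (q.2.1.2 : Set QT),
      Data.ofBool q.2.2.1, encElem eI q.2.2.2]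

/-- The input consisting of an RTS, a state `q`, a letter `a` and a state `q'`. -/
noncomputable def encInput [Fintype QT] {k m n : ℕ} (eα : α ≃ Fin k) (eI : QI ≃ Fin m)
    (eT : QT ≃ Fin n) (R : RTS α QI QT) (q : SepState QI QT) (a : α) (q' : SepState QI QT) : Data :=
  Data.ofList [encRTS eα eI eT R, encState eI eT q, encElem eα a, encState eI eT q']

end RegularMC

namespace RegularMC

/-! ### Closure properties of polynomial time on trees -/

/-! For a clause of length l, let D j be the set of letters it does not mention at position j. A
word of length l violates the clause iff all its letters lie in D, and the clause is inductive iff D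
is closed backwards: a run of the transducer with all output letters in D has all input letters in
D. A word w has a least such D, found by repeatedly adding the input letters of runs whose output
letters are already derived; w is in `Ind 1` iff some initial word consists of derived letters.

The automaton checks this column by column. At each boundary it guesses the order in which the runs
first visit states, and it fills each column with edges in an order compatible with the guesses on
both sides, each edge outputting a derived letter. A sequence of runs projects to such fillings
(`Derivation.firing`, hence `sepNFA_complete`). Conversely, neighbouring fillings share only the
order at their boundary, and `Firing.all_good` shows that this suffices: every edge used lies on a
run with output letters in D, for every closed D containing w (hence `sepNFA_sound`). Only the tuple
and the `QI` component of a state carry information.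

Usability of an edge is monotone in the edges already used, so greedy saturation finds a largest
filling and decides a transition (`mem_step_sepNFA_iff`). On trees it is a nested fold, kept
polynomial by `PolyTime.fold`. -/

theorem eval_mono (p : Polynomial ℕ) {m n : ℕ} (h : m ≤ n) : p.eval m ≤ p.eval n := by
  rw [Polynomial.eval_eq_sum, Polynomial.eval_eq_sum]
  exact Finset.sum_le_sum fun i _ => Nat.mul_le_mul_left _ (Nat.pow_le_pow_left h i)

/-- `f` is computed by programs that read and write the variable `k` (any `k`), leave the variables
below `k` alone, and take polynomial time; moreover its values have polynomial size. -/
def PolyTime (f : Data → Data) : Prop :=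
  ∃ p : Polynomial ℕ, (∀ d, (f d).size ≤ p.eval d.size) ∧
    ∀ k : ℕ, ∃ c : Prog, ∀ s : Store, ∃ (s' : Store) (t : ℕ), Exec c s s' t ∧
      t ≤ p.eval (s k).size ∧ s' k = f (s k) ∧ ∀ i < k, s' i = s i

namespace PolyTime

open Polynomial

variable {f g h : Data → Data}

theorem id : PolyTime fun d => d := by
  refine ⟨X + C 2, fun d => by simp, fun k => ⟨.assign k (.var k), fun s =>
    ⟨_, _, .assign _ _ _, ?_, by simp [Expr.eval], fun i hi => ?_⟩⟩⟩
  · simp [Expr.cost]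
  · simp [hi.ne]

theorem nil : PolyTime fun _ => Data.nil := by
  refine ⟨X + C 2, fun d => by simp [Data.size], fun k => ⟨.assign k .nil, fun s =>
    ⟨_, _, .assign _ _ _, ?_, by simp [Expr.eval], fun i hi => ?_⟩⟩⟩
  · simp [Expr.cost]
  · simp [hi.ne]

theorem hd (hf : PolyTime f) : PolyTime fun d => (f d).hd := by
  obtain ⟨p, hp, hc⟩ := hf
  refine ⟨p + C 4, fun d => ?_, fun k => ?_⟩
  · have : (f d).hd.size ≤ (f d).size := by
      cases f d <;> simp [Data.hd, Data.size]
      omega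
    have := hp d
    simp; omega
  obtain ⟨c, hc⟩ := hc k
  refine ⟨.seq c (.assign k (.hd (.var k))), fun s => ?_⟩
  obtain ⟨s', t, h1, h2, h3, h4⟩ := hc s
  refine ⟨_, _, .seq h1 (.assign _ _ _), ?_, by simp [Expr.eval, h3], fun i hi => ?_⟩
  · simp [Expr.cost]; omega
  · simp [hi.ne, h4 i hi]

theorem tl (hf : PolyTime f) : PolyTime fun d => (f d).tl := by
  obtain ⟨p, hp, hc⟩ := hf
  refine ⟨p + C 4, fun d => ?_, fun k => ?_⟩
  · have : (f d).tl.size ≤ (f d).size := by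
      cases f d <;> simp [Data.tl, Data.size]
      omega
    have := hp d
    simp; omega
  obtain ⟨c, hc⟩ := hc k
  refine ⟨.seq c (.assign k (.tl (.var k))), fun s => ?_⟩
  obtain ⟨s', t, h1, h2, h3, h4⟩ := hc s
  refine ⟨_, _, .seq h1 (.assign _ _ _), ?_, by simp [Expr.eval, h3], fun i hi => ?_⟩
  · simp [Expr.cost]; omega
  · simp [hi.ne, h4 i hi]

theorem comp (hg : PolyTime g) (hf : PolyTime f) : PolyTime fun d => g (f d) := by
  obtain ⟨p, hp, hc⟩ := hf
  obtain ⟨q, hq, hd⟩ := hg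
  refine ⟨p + q.comp p + C 1, fun d => ?_, fun k => ?_⟩
  · have := hq (f d)
    have := eval_mono q (hp d)
    simp; omega
  obtain ⟨c, hc⟩ := hc k
  obtain ⟨c', hc'⟩ := hd k
  refine ⟨.seq c c', fun s => ?_⟩
  obtain ⟨s', t, h1, h2, h3, h4⟩ := hc s
  obtain ⟨s'', t', h1', h2', h3', h4'⟩ := hc' s'
  refine ⟨_, _, .seq h1 h1', ?_, by rw [h3', h3], fun i hi => by rw [h4' i hi, h4 i hi]⟩
  rw [h3] at h2'
  have := eval_mono q (hp (s k))
  simp; omega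

/-- Computes the value of a function of variable `k` in a variable above `k`. -/
theorem call (hf : PolyTime f) : ∃ p : Polynomial ℕ, (∀ d, (f d).size ≤ p.eval d.size) ∧
    ∀ k j : ℕ, k < j → ∃ c : Prog, ∀ s : Store, ∃ (s' : Store) (t : ℕ), Exec c s s' t ∧
      t ≤ p.eval (s k).size ∧ s' j = f (s k) ∧ ∀ i < j, s' i = s i := by
  obtain ⟨p, hp, hc⟩ := hf
  refine ⟨p + C 3, fun d => by have := hp d; simp; omega, fun k j hkj => ?_⟩
  obtain ⟨c, hc⟩ := hc j
  refine ⟨.seq (.assign j (.var k)) c, fun s => ?_⟩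
  obtain ⟨s', t, h1, h2, h3, h4⟩ := hc (Function.update s j (s k))
  refine ⟨_, _, .seq (.assign _ _ _) h1, ?_, by simpa using h3, fun i hi => ?_⟩
  · simp at h2
    simp [Expr.cost]; omega
  · rw [h4 i hi]; simp [hi.ne]

theorem cons (hf : PolyTime f) (hg : PolyTime g) : PolyTime fun d => Data.cons (f d) (g d) := by
  obtain ⟨p, hp, hc⟩ := hf.call
  obtain ⟨q, hq, hd⟩ := hg.call
  refine ⟨p + q + C 6, fun d => ?_, fun k => ?_⟩
  · have := hp d
    have := hq d
    simp [Data.size]; omega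
  obtain ⟨c, hc⟩ := hc k (k + 1) (by omega)
  obtain ⟨c', hc'⟩ := hd k (k + 2) (by omega)
  refine ⟨.seq (.seq c c') (.assign k (.cons (.var (k + 1)) (.var (k + 2)))), fun s => ?_⟩
  obtain ⟨s', t, h1, h2, h3, h4⟩ := hc s
  obtain ⟨s'', t', h1', h2', h3', h4'⟩ := hc' s'
  have e : s' k = s k := h4 k (by omega)
  refine ⟨_, _, .seq (.seq h1 h1') (.assign _ _ _), ?_, ?_, fun i hi => ?_⟩
  · rw [e] at h2'
    simp [Expr.cost]; omega
  · simp only [Function.update_self, Expr.eval, h3', h4' (k + 1) (by omega), h3, e]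
  · simp only [Function.update_of_ne hi.ne, h4' i (by omega), h4 i (by omega)]

theorem ite [∀ d, Decidable (f d ≠ Data.nil)] (hf : PolyTime f) (hg : PolyTime g)
    (hh : PolyTime h) :
    PolyTime fun d => if f d ≠ Data.nil then g d else h d := by
  obtain ⟨p, hp, hc⟩ := hf.call
  obtain ⟨q, hq, hd⟩ := hg
  obtain ⟨r, hr, he⟩ := hh
  refine ⟨p + q + r + C 3, fun d => ?_, fun k => ?_⟩
  · have := hq d
    have := hr d
    dsimp only
    split_ifs <;> simp <;> omega
  obtain ⟨c, hc⟩ := hc k (k + 1) (by omega)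
  obtain ⟨c₁, h₁⟩ := hd k
  obtain ⟨c₂, h₂⟩ := he k
  refine ⟨.seq c (.cond (.var (k + 1)) c₁ c₂), fun s => ?_⟩
  obtain ⟨s', t, a1, a2, a3, a4⟩ := hc s
  have e : s' k = s k := a4 k (by omega)
  by_cases hb : f (s k) = Data.nil
  · obtain ⟨s'', t', b1, b2, b3, b4⟩ := h₂ s'
    refine ⟨_, _, .seq a1 (.condFalse (by simp [Expr.eval, a3, hb]) b1), ?_, ?_, fun i hi => ?_⟩
    · rw [e] at b2
      simp [Expr.cost]; omega
    · simp [b3, e, hb]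
    · rw [b4 i hi, a4 i (by omega)]
  · obtain ⟨s'', t', b1, b2, b3, b4⟩ := h₁ s'
    refine ⟨_, _, .seq a1 (.condTrue (by simp [Expr.eval, a3, hb]) b1), ?_, ?_, fun i hi => ?_⟩
    · rw [e] at b2
      simp [Expr.cost]; omega
    · simp [b3, e, hb]
    · rw [b4 i hi, a4 i (by omega)]

end PolyTime

/-! ### Trees as lists, and iteration along a list. -/

namespace Data

@[simp] theorem hd_nil : hd nil = nil := rfl

@[simp] theorem tl_nil : tl nil = nil := rfl

@[simp] theorem hd_cons (l r : Data) : hd (cons l r) = l := rfl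

@[simp] theorem tl_cons (l r : Data) : tl (cons l r) = r := rfl

/-- A tree, read as the list of its left subtrees along the right spine. -/
def toList : Data → List Data
  | nil => []
  | cons x r => x :: toList r

@[simp] theorem toList_ofList (l : List Data) : (ofList l).toList = l := by
  induction l with
  | nil => rfl
  | cons x l ih => simp [ofList, toList, ih]

/-- Iterates `g` along a list, with an accumulator `a` and a constant context `c`. -/
def fold (g : Data → Data) (c l a : Data) : Data :=
  l.toList.foldl (fun a x => g (cons c (cons x a))) a

/-- The growth per step may depend on the context and the element but not on the accumulator;
otherwise iteration could make sizes explode. -/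
theorem fold_size {g : Data → Data} {q : Polynomial ℕ} {c : Data}
    (hq : ∀ x a, (g (cons c (cons x a))).size ≤ a.size + q.eval (c.size + x.size))
    (l a : Data) : (fold g c l a).size ≤ a.size + l.size * q.eval (c.size + l.size) := by
  -- `S` keeps the size of the whole list while the induction shortens the list, so one growth bound
  -- serves all steps.
  suffices h : ∀ (S : ℕ) (l a : Data), l.size ≤ S →
      (fold g c l a).size ≤ a.size + l.size * q.eval (c.size + S) from h l.size l a le_rfl
  intro S l
  induction l with
  | nil => intro a _; simp [fold, toList]
  | cons x r _ ih =>
    intro a hl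
    simp only [size] at hl ⊢
    have h1 := ih (g (cons c (cons x a))) (by omega)
    have h2 := hq x a
    have h3 : q.eval (c.size + x.size) ≤ q.eval (c.size + S) := eval_mono q (by omega)
    have h4 : fold g c (cons x r) a = fold g c r (g (cons c (cons x a))) := rfl
    rw [h4]
    have h5 : (r.size + 1) * q.eval (c.size + S) ≤ (x.size + r.size + 1) * q.eval (c.size + S) :=
      Nat.mul_le_mul_right _ (by omega)
    rw [add_mul] at h5
    omega

end Data

namespace PolyTime

open Polynomial

variable {g l a : Data → Data}

/-- The loop that iterates `g` along the list in variable `k + 1`, with accumulator in variable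
`k + 2` and context in variable `k`. -/
theorem fold_loop {g : Data → Data} {p q : Polynomial ℕ} {k : ℕ} {c : Prog}
    (hc : ∀ s : Store, ∃ (s' : Store) (t : ℕ), Exec c s s' t ∧
      t ≤ p.eval (s (k + 3)).size ∧ s' (k + 3) = g (s (k + 3)) ∧ ∀ i < k + 3, s' i = s i)
    {d : Data}
    (hq : ∀ x a, (g (.cons d (.cons x a))).size ≤ a.size + q.eval (d.size + x.size))
    (S W : ℕ) (l : Data) : ∀ (s : Store), s k = d → s (k + 1) = l → l.size ≤ S →
      (s (k + 2)).size + l.size * q.eval (d.size + S) ≤ W →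
      ∃ (s' : Store) (t : ℕ),
        Exec (.loop (.var (k + 1)) (.seq (.assign (k + 3)
          (.cons (.var k) (.cons (.hd (.var (k + 1))) (.var (k + 2)))))
          (.seq c (.seq (.assign (k + 2) (.var (k + 3))) (.assign (k + 1) (.tl (.var (k + 1))))))))
          s s' t ∧ t ≤ l.size * (p.eval (d.size + S + W + 2) + 20) + 2 ∧
        s' (k + 2) = Data.fold g d l (s (k + 2)) ∧ ∀ i ≤ k, s' i = s i := by
  -- `W` bounds the accumulator plus all growth still to come. This invariant survives each
  -- iteration and bounds every argument passed to `g`.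
  induction l with
  | nil =>
    intro s _ hl _ _
    exact ⟨s, _, .loopFalse (by simpa [Expr.eval] using hl), by simp [Expr.cost], rfl,
      fun i _ => rfl⟩
  | cons x r _ ih =>
    intro s hk hl hS hW
    simp only [Data.size] at hS hW
    set s₁ := Function.update s (k + 3) (.cons d (.cons x (s (k + 2)))) with hs₁
    obtain ⟨s₂, t₂, b1, b2, b3, b4⟩ := hc s₁
    have e1 : s₁ (k + 3) = .cons d (.cons x (s (k + 2))) := by simp [hs₁]
    rw [e1] at b2 b3
    set s₃ := Function.update s₂ (k + 2) (s₂ (k + 3)) with hs₃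
    set s₄ := Function.update s₃ (k + 1) (s₃ (k + 1)).tl with hs₄
    have f1 : s₂ (k + 1) = .cons x r := by rw [b4 _ (by omega), hs₁]; simp [hl]
    have f2 : s₄ (k + 1) = r := by simp [hs₄, hs₃, f1, Data.tl]
    have f3 : s₄ (k + 2) = g (.cons d (.cons x (s (k + 2)))) := by simp [hs₄, hs₃, b3]
    have f4 : ∀ i ≤ k, s₄ i = s i := by
      intro i hi
      rw [hs₄, Function.update_of_ne (by omega), hs₃, Function.update_of_ne (by omega),
        b4 _ (by omega), hs₁, Function.update_of_ne (by omega)]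
    have h2 := hq x (s (k + 2))
    have h3 : q.eval (d.size + x.size) ≤ q.eval (d.size + S) := eval_mono q (by omega)
    have h5 : (r.size + 1) * q.eval (d.size + S) ≤ (x.size + r.size + 1) * q.eval (d.size + S) :=
      Nat.mul_le_mul_right _ (by omega)
    rw [add_mul (r.size)] at h5
    obtain ⟨s₅, t₅, c1, c2, c3, c4⟩ := ih s₄ (by rw [f4 k le_rfl, hk]) f2 (by omega)
      (by rw [f3]; omega)
    have ev : Expr.eval s (.cons (.var k) (.cons (.hd (.var (k + 1))) (.var (k + 2)))) =
        .cons d (.cons x (s (k + 2))) := by simp [Expr.eval, hk, hl, Data.hd]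
    have x1 := Exec.assign (k + 3)
      (.cons (.var k) (.cons (.hd (.var (k + 1))) (.var (k + 2)))) s
    rw [ev] at x1
    have x2 : Exec (.assign (k + 2) (.var (k + 3))) s₂ s₃ 2 := Exec.assign _ _ _
    have x3 : Exec (.assign (k + 1) (.tl (.var (k + 1)))) s₃ s₄ 3 := Exec.assign _ _ _
    refine ⟨s₅, _, .loopTrue (by simp [Expr.eval, hl]) (.seq x1 (.seq b1 (.seq x2 x3))) c1,
      ?_, ?_, fun i hi => by rw [c4 i hi, f4 i hi]⟩
    · have h6 : p.eval (Data.size (.cons d (.cons x (s (k + 2))))) ≤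
          p.eval (d.size + S + W + 2) := eval_mono p (by simp only [Data.size]; omega)
      have h7 := Nat.mul_le_mul_right (p.eval (d.size + S + W + 2) + 20)
        (show r.size + 1 ≤ x.size + r.size + 1 by omega)
      rw [add_mul (r.size)] at h7
      simp only [Expr.cost, Data.size]
      simp only [Data.size] at b2 h6
      omega
    · rw [c3, f3]; rfl

theorem fold (hg : PolyTime g) (q : Polynomial ℕ)
    (hq : ∀ c x a, (g (.cons c (.cons x a))).size ≤ a.size + q.eval (c.size + x.size))
    (hl : PolyTime l) (ha : PolyTime a) : PolyTime fun d => Data.fold g d (l d) (a d) := by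
  obtain ⟨p, hp, hc⟩ := hg
  obtain ⟨pl, hpl, hcl⟩ := hl.call
  obtain ⟨pa, hpa, hca⟩ := ha.call
  -- Initial accumulator, plus list size times growth per step.
  set W : Polynomial ℕ := pa + pl * q.comp (X + pl) with hW
  refine ⟨W + pl + pa + pl * (p.comp (X + pl + W + C 2) + C 20) + C 10, fun d => ?_, fun k => ?_⟩
  · have h1 := Data.fold_size (hq d) (l d) (a d)
    have h2 := Nat.mul_le_mul (hpl d) (eval_mono q (Nat.add_le_add_left (hpl d) d.size))
    have h3 := hpa d
    simp only [hW, eval_add, eval_mul, eval_comp, eval_X, eval_C]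
    omega
  obtain ⟨c, hc⟩ := hc (k + 3)
  obtain ⟨cl, hcl⟩ := hcl k (k + 1) (by omega)
  obtain ⟨ca, hca⟩ := hca k (k + 2) (by omega)
  refine ⟨.seq (.seq (.seq cl ca) (.loop (.var (k + 1)) (.seq (.assign (k + 3)
          (.cons (.var k) (.cons (.hd (.var (k + 1))) (.var (k + 2)))))
          (.seq c (.seq (.assign (k + 2) (.var (k + 3)))
            (.assign (k + 1) (.tl (.var (k + 1)))))))))
          (.assign k (.var (k + 2))), fun s => ?_⟩
  obtain ⟨s₁, t₁, a1, a2, a3, a4⟩ := hcl s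
  obtain ⟨s₂, t₂, b1, b2, b3, b4⟩ := hca s₁
  have e1 : s₁ k = s k := a4 k (by omega)
  have e2 : s₂ k = s k := by rw [b4 k (by omega), e1]
  have e3 : s₂ (k + 1) = l (s k) := by rw [b4 _ (by omega), a3]
  rw [e1] at b2 b3
  have hw : (s₂ (k + 2)).size + (l (s k)).size * q.eval ((s k).size + pl.eval (s k).size) ≤
      W.eval (s k).size := by
    simp only [b3, hW, eval_add, eval_mul, eval_comp, eval_X]
    exact Nat.add_le_add (hpa _) (Nat.mul_le_mul_right _ (hpl _))
  obtain ⟨s₃, t₃, c1, c2, c3, c4⟩ := fold_loop hc (hq (s k)) (pl.eval (s k).size)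
    (W.eval (s k).size) (l (s k)) s₂ e2 e3 (hpl _) hw
  refine ⟨_, _, .seq (.seq (.seq a1 b1) c1) (.assign _ _ _), ?_, ?_, fun i hi => ?_⟩
  · have h2 := Nat.mul_le_mul_right
      (p.eval ((s k).size + pl.eval (s k).size + W.eval (s k).size + 2) + 20) (hpl (s k))
    simp only [eval_add, eval_mul, eval_comp, eval_X, eval_C, Expr.cost]
    omega
  · simp [Expr.eval, c3, b3]
  · rw [Function.update_of_ne hi.ne, c4 i hi.le, b4 i (by omega), a4 i (by omega)]

end PolyTime

/-! ### Predicates decidable in polynomial time -/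

/-- The predicate is decided by a polynomial-time function. -/
def PolyDec (P : Data → Prop) : Prop :=
  ∃ f, PolyTime f ∧ ∀ d, (f d).size ≤ 3 ∧ (f d ≠ Data.nil ↔ P d)

namespace PolyDec

variable {P Q : Data → Prop} {f g l : Data → Data}

theorem tt : PolyTime fun _ => Data.cons .nil .nil := .cons .nil .nil

theorem ite (hP : PolyDec P) [DecidablePred P] (hf : PolyTime f) (hg : PolyTime g) :
    PolyTime fun d => if P d then f d else g d := by
  classical
  obtain ⟨b, hb, h⟩ := hP
  convert hb.ite hf hg using 3 with d
  exact (h d).2.symm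

theorem of_bool [DecidablePred P] (hf : PolyTime fun d => if P d then Data.cons .nil .nil else .nil) :
    PolyDec P :=
  ⟨_, hf, fun d => by split_ifs with h <;> simp [h, Data.size]⟩

open Classical in
theorem ne_nil (hf : PolyTime f) : PolyDec fun d => f d ≠ Data.nil :=
  of_bool (hf.ite tt .nil)

open Classical in
theorem not (hP : PolyDec P) : PolyDec fun d => ¬ P d :=
  of_bool <| by
    convert hP.ite .nil tt using 2 with d
    by_cases h : P d <;> simp [h]

open Classical in
theorem and (hP : PolyDec P) (hQ : PolyDec Q) : PolyDec fun d => P d ∧ Q d :=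
  of_bool <| by
    convert hP.ite (hQ.ite tt .nil) .nil using 2 with d
    by_cases h : P d <;> simp [h]

theorem or (hP : PolyDec P) (hQ : PolyDec Q) : PolyDec fun d => P d ∨ Q d := by
  simpa only [not_and_or, not_not] using (hP.not.and hQ.not).not

theorem comp (hP : PolyDec P) (hf : PolyTime f) : PolyDec fun d => P (f d) := by
  obtain ⟨b, hb, h⟩ := hP
  exact ⟨_, hb.comp hf, fun d => h (f d)⟩

open Classical in
/-- Some element of the list satisfies `P`, and all later ones satisfy `Q`. -/
theorem since (hP : PolyDec P) (hQ : PolyDec Q) (hl : PolyTime l) :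
    PolyDec fun d => ∃ A x B, (l d).toList = A ++ x :: B ∧ P (.cons d x) ∧
      ∀ z ∈ B, Q (.cons d z) := by
  have hx : PolyTime fun d => Data.cons d.hd d.tl.hd := .cons (.hd .id) (.hd (.tl .id))
  -- One pass with a flag: the new flag is `P ∨ (Q ∧ old flag)`. Its size never exceeds 3, whence
  -- the constant growth bound.
  have hstep : PolyTime fun d : Data => if P (.cons d.hd d.tl.hd) ∨ Q (.cons d.hd d.tl.hd) ∧
      d.tl.tl ≠ Data.nil then Data.cons .nil .nil else .nil :=
    ((hP.comp hx).or ((hQ.comp hx).and (ne_nil (.tl (.tl .id))))).ite tt .nil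
  have hfold := hstep.fold (Polynomial.C 3) (fun c x a => by
    split_ifs <;> simp [Data.size]) hl .nil
  refine ⟨_, hfold, fun d => ?_⟩
  simp only [Data.fold, Data.hd, Data.tl]
  generalize (l d).toList = L
  induction L using List.reverseRecOn with
  | nil => simp [Data.size]
  | append_singleton L y ih =>
    simp only [List.foldl_append, List.foldl_cons, List.foldl_nil, ih.2]
    refine ⟨by split_ifs <;> simp [Data.size], ?_⟩
    simp only [ite_eq_right_iff, reduceCtorEq, imp_false, not_not, ne_eq]
    constructor
    · rintro (h | ⟨h, A, x, B, rfl, hx, hB⟩)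
      · exact ⟨L, y, [], rfl, h, by simp⟩
      · refine ⟨A, x, B ++ [y], by simp, hx, ?_⟩
        simpa [or_imp, forall_and] using ⟨hB, h⟩
    · rintro ⟨A, x, B, h, hx, hB⟩
      rcases List.eq_nil_or_concat B with rfl | ⟨B, z, rfl⟩
      · obtain ⟨rfl, h⟩ := List.append_inj' h rfl
        simp at h
        exact .inl (h ▸ hx)
      · rw [List.concat_eq_append, ← List.cons_append, ← List.append_assoc] at h
        obtain ⟨rfl, h⟩ := List.append_inj' h rfl
        simp at h
        subst h
        simp [or_imp, forall_and] at hB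
        exact .inr ⟨hB.2, A, x, B, rfl, hx, hB.1⟩

theorem ex (hP : PolyDec P) (hl : PolyTime l) :
    PolyDec fun d => ∃ x ∈ (l d).toList, P (.cons d x) := by
  -- `P ∨ ¬P` makes the condition on later elements void.
  have := hP.since (hP.or hP.not) hl
  convert this using 2 with d
  constructor
  · rintro ⟨x, hx, h⟩
    obtain ⟨A, B, e⟩ := List.append_of_mem hx
    exact ⟨A, x, B, e, h, fun z _ => em _⟩
  · rintro ⟨A, x, B, e, h, -⟩
    exact ⟨x, by simp [e], h⟩

theorem all (hP : PolyDec P) (hl : PolyTime l) :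
    PolyDec fun d => ∀ x ∈ (l d).toList, P (.cons d x) := by
  have := (hP.not.ex hl).not
  simpa only [not_exists, not_and, not_not] using this

open Classical in
/-- Two lists have the same length. In particular, two numbers in unary are equal. -/
theorem length_eq (hf : PolyTime f) (hg : PolyTime g) :
    PolyDec fun d => (f d).toList.length = (g d).toList.length := by
  -- The accumulator pairs a flag with the unread part of `g d`. Each element of `f d` consumes one
  -- entry; if none is left, the flag is cleared for good. The lengths agree iff the flag survives
  -- and nothing remains unread.
  have hstep : PolyTime fun d : Data => if d.tl.tl.tl ≠ Data.nil then
      Data.cons d.tl.tl.hd d.tl.tl.tl.tl else .cons .nil .nil :=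
    (ne_nil (.tl (.tl (.tl .id)))).ite (.cons (.hd (.tl (.tl .id))) (.tl (.tl (.tl (.tl .id))))) tt
  have hsize : ∀ c x a : Data, (if (Data.cons c (.cons x a)).tl.tl.tl ≠ Data.nil then
      Data.cons (Data.cons c (.cons x a)).tl.tl.hd (Data.cons c (.cons x a)).tl.tl.tl.tl
      else .cons .nil .nil).size ≤ a.size + (Polynomial.C 3).eval (c.size + x.size) := by
    intro c x a
    rcases a with _ | ⟨a, _ | ⟨b, b'⟩⟩ <;> simp [Data.tl, Data.hd, Data.size]
    omega
  have hfold := hstep.fold (Polynomial.C 3) hsize hf (.cons tt hg)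
  have := (ne_nil (.hd hfold)).and (ne_nil (.tl hfold)).not
  convert this using 2 with d
  simp only [Data.fold, Data.tl_cons]
  have key : ∀ F : Data → Data, (∀ b y r, F (.cons b (.cons y r)) = .cons b r) →
      (∀ b, F (.cons b .nil) = .cons .nil .nil) → ∀ (L : List Data) (b r : Data),
      (b = .nil → r = .nil) → (L.length = r.toList.length ∧ b ≠ .nil ↔
        (L.foldl (fun a _ => F a) (.cons b r)).hd ≠ .nil ∧
          ¬ (L.foldl (fun a _ => F a) (.cons b r)).tl ≠ .nil) := by
    intro F h1 h2 L
    induction L with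
    | nil =>
      intro b r _
      cases r <;> simp [Data.toList, and_comm]
    | cons x L ih =>
      intro b r hb
      cases r with
      | nil => simpa [Data.toList, h2] using ih .nil .nil (fun _ => rfl)
      | cons y r => simpa [Data.toList, h1] using ih b r (fun h => by simpa using hb h)
  refine Iff.trans ?_ (key (fun a => if a.tl ≠ Data.nil then Data.cons a.hd a.tl.tl else
    .cons .nil .nil) (fun b y r => by simp) (fun b => by simp) (f d).toList
    (.cons .nil .nil) (g d) (by simp))
  simp

end PolyDec

end RegularMC

namespace RegularMC

variable {α QI QT : Type*}

/-! ### The automaton -/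

/-- An edge of a transducer: source, input letter, output letter, target. -/
abbrev Edge (α QT : Type*) := QT × α × α × QT

/-- `q` occurs in the list `l`, and all states that occur after it belong to `F`. -/
def Ready {Q : Type*} (l : List (Option Q)) (F : Set Q) (q : Q) : Prop :=
  ∃ A B, l = A ++ some q :: B ∧ ∀ p, some p ∈ B → p ∈ F

/-- The letter is `a` or the input letter of an edge of `L`. -/
def Produced (a : α) (L : List (Edge α QT)) (x : α) : Prop := x = a ∨ ∃ f ∈ L, f.2.1 = x

/-- The edge `e` may be used after the edges of `L`, between the lists of states `s` and `s'`,
whose states are to be visited in the order from right to left. -/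
def Usable (T : NFA (α × α) QT) (s s' : List (Option QT)) (a : α) (L : List (Edge α QT))
    (e : Edge α QT) : Prop :=
  e.2.2.2 ∈ T.step e.1 (e.2.1, e.2.2.1) ∧ Produced a L e.2.2.1 ∧
    Ready s {p | ∃ f ∈ L, f.1 = p} e.1 ∧ Ready s' {p | ∃ f ∈ L, f.2.2.2 = p} e.2.2.2

/-- Lists of edges (latest first) in which each edge is usable after the earlier ones. -/
inductive Firing (T : NFA (α × α) QT) (s s' : List (Option QT)) (a : α) : List (Edge α QT) → Prop
  | nil : Firing T s s' a []
  | cons {e : Edge α QT} {L : List (Edge α QT)} :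
      Firing T s s' a L → Usable T s s' a L e → Firing T s s' a (e :: L)

/-- The edges of `L` visit all states in `s` and in `s'`. -/
def Covers (s s' : List (Option QT)) (L : List (Edge α QT)) : Prop :=
  (∀ p, some p ∈ s → ∃ f ∈ L, f.1 = p) ∧ ∀ p, some p ∈ s' → ∃ f ∈ L, f.2.2.2 = p

/-- The automaton for `Ind 1`. It guesses, at each boundary between letters, the states that are
visited there by the runs of the transducer that derive letters from the input word, in the order of
their first visits; and it simulates the initial automaton on a word of derived letters. -/
def sepNFA [Fintype QT] (R : RTS α QI QT) : NFA α (SepState QI QT) where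
  step q a := {q' | ∃ L, Firing R.transducer (List.ofFn q.1) (List.ofFn q'.1) a L ∧
    Covers (List.ofFn q.1) (List.ofFn q'.1) L ∧
    ∃ x, Produced a L x ∧ q'.2.2.2 ∈ R.initial.step q.2.2.2 x}
  start := {q | (∀ p, some p ∈ List.ofFn q.1 → p ∈ R.transducer.start) ∧
    q.2.2.2 ∈ R.initial.start}
  accept := {q | (∀ p, some p ∈ List.ofFn q.1 → p ∈ R.transducer.accept) ∧
    q.2.2.2 ∈ R.initial.accept}

theorem Ready.mem {Q : Type*} {l : List (Option Q)} {F : Set Q} {q : Q} (h : Ready l F q) :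
    some q ∈ l := by
  obtain ⟨A, B, rfl, -⟩ := h
  simp

/-- Of two occurrences in one list, the one further right is among the states required by the other.
In the soundness proof this decides which of two edges meeting at a boundary comes first. -/
theorem Ready.compare {Q : Type*} {l : List (Option Q)} {F G : Set Q} {p q : Q}
    (hp : Ready l F p) (hq : Ready l G q) : p = q ∨ p ∈ G ∨ q ∈ F := by
  obtain ⟨A, B, rfl, hF⟩ := hp
  obtain ⟨A', B', e, hG⟩ := hq
  rcases List.append_eq_append_iff.1 e with ⟨C, rfl, h⟩ | ⟨C, rfl, h⟩
  · rcases C with _ | ⟨c, C⟩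
    · simp at h; exact .inl h.1
    · simp at h; exact .inr (.inr (hF q (by simp [h.2])))
  · rcases C with _ | ⟨c, C⟩
    · simp at h; exact .inl h.1.symm
    · simp at h; exact .inr (.inl (hG p (by simp [h.2])))

/-! ### Runs as sequences of states -/

/-- Words and runs become functions on `ℕ` with irrelevant values past the end, so runs can be cut
and pasted without dependent indices. -/
theorem mem_evalFrom_iff {σ : Type*} (A : NFA α σ) (S : Set σ) (x : ℕ → α) (l : ℕ) (q : σ) :
    q ∈ A.evalFrom S ((List.range l).map x) ↔
      ∃ τ : ℕ → σ, τ 0 ∈ S ∧ τ l = q ∧ ∀ j < l, τ (j + 1) ∈ A.step (τ j) (x j) := by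
  induction l generalizing q with
  | zero =>
    simp only [List.range_zero, List.map_nil, NFA.evalFrom_nil, not_lt_zero, false_imp_iff,
      implies_true, and_true]
    exact ⟨fun h => ⟨fun _ => q, h, rfl⟩, fun ⟨τ, h, e⟩ => e ▸ h⟩
  | succ l ih =>
    rw [List.range_succ, List.map_append, NFA.evalFrom_append, List.map_singleton,
      NFA.evalFrom_singleton, NFA.mem_stepSet]
    constructor
    · rintro ⟨t, ht, hq⟩
      obtain ⟨τ, h0, rfl, h⟩ := (ih t).1 ht
      refine ⟨fun j => if j ≤ l then τ j else q, by simpa using h0, by simp, fun j hj => ?_⟩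
      rcases Nat.lt_succ_iff_lt_or_eq.1 hj with h' | rfl
      · simpa [h'.le, Nat.succ_le_of_lt h'] using h j h'
      · simpa using hq
    · rintro ⟨τ, h0, rfl, h⟩
      exact ⟨τ l, (ih _).2 ⟨τ, h0, rfl, fun j hj => h j (by omega)⟩, h l (by omega)⟩

theorem mem_accepts_iff {σ : Type*} (A : NFA α σ) (x : ℕ → α) (l : ℕ) :
    (List.range l).map x ∈ A.accepts ↔ ∃ τ : ℕ → σ, τ 0 ∈ A.start ∧ τ l ∈ A.accept ∧
      ∀ j < l, τ (j + 1) ∈ A.step (τ j) (x j) := by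
  rw [NFA.mem_accepts]
  constructor
  · rintro ⟨q, hq, h⟩
    obtain ⟨τ, h0, rfl, h'⟩ := (mem_evalFrom_iff A _ x l q).1 h
    exact ⟨τ, h0, hq, h'⟩
  · rintro ⟨τ, h0, hl, h⟩
    exact ⟨τ l, hl, (mem_evalFrom_iff A _ x l _).2 ⟨τ, h0, rfl, h⟩⟩

theorem nil_mem_accepts_iff {σ : Type*} (A : NFA α σ) :
    [] ∈ A.accepts ↔ ∃ q ∈ A.start, q ∈ A.accept := by
  simp [NFA.mem_accepts, and_comm]

theorem exists_eq_map_range [Nonempty α] (w : List α) :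
    ∃ x : ℕ → α, w = (List.range w.length).map x := by
  refine ⟨fun j => w.getD j (Classical.arbitrary α), List.ext_getElem (by simp) fun i h1 h2 => ?_⟩
  simp [h1]

theorem sat_singleton_iff {l : ℕ} (c : Clause α l) (x : ℕ → α) :
    Formula.Sat [c] ((List.range l).map x) ↔ ∃ p ∈ c, x p.2 = p.1 := by
  simp [Formula.Sat]

/-- A run of a transducer on a pair of words of length `l`. -/
structure Run (T : NFA (α × α) QT) (l : ℕ) where
  st : ℕ → QT
  x : ℕ → α
  y : ℕ → α
  start : st 0 ∈ T.start
  accept : st l ∈ T.accept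
  step : ∀ j < l, st (j + 1) ∈ T.step (st j) (x j, y j)

theorem Run.trans {R : RTS α QI QT} {l : ℕ} (r : Run R.transducer l) :
    R.Trans ((List.range l).map r.x) ((List.range l).map r.y) :=
  ⟨(List.range l).map fun j => (r.x j, r.y j),
    (mem_accepts_iff _ _ _).2 ⟨r.st, r.start, r.accept, r.step⟩, by simp, by simp⟩

theorem RTS.Trans.exists_run [Nonempty α] {R : RTS α QI QT} {w u : List α} (h : R.Trans w u)
    {l : ℕ} (hl : w.length = l) : ∃ r : Run R.transducer l,
      w = (List.range l).map r.x ∧ u = (List.range l).map r.y := by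
  obtain ⟨v, hv, rfl, rfl⟩ := h
  subst hl
  obtain ⟨z, hz⟩ := exists_eq_map_range v
  rw [hz, mem_accepts_iff] at hv
  obtain ⟨τ, h0, hl, h⟩ := hv
  refine ⟨⟨τ, fun j => (z j).1, fun j => (z j).2, h0, by simpa using hl, by simpa using h⟩, ?_, ?_⟩
  · conv_lhs => rw [hz]
    simp
  · conv_lhs => rw [hz]
    simp

/-! ### Soundness -/

section Soundness

variable (T : NFA (α × α) QT) (l : ℕ) (D : ℕ → Set α)

/-- `q` is reached at boundary `j` by a run that reads output letters in `D`. -/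
def Fwd (j : ℕ) (q : QT) : Prop :=
  ∃ (st : ℕ → QT) (x y : ℕ → α), st 0 ∈ T.start ∧ st j = q ∧
    ∀ i < j, st (i + 1) ∈ T.step (st i) (x i, y i) ∧ y i ∈ D i

/-- From `q` at boundary `j`, some run that reads output letters in `D` is accepting. -/
def Bwd (j : ℕ) (q : QT) : Prop :=
  ∃ (st : ℕ → QT) (x y : ℕ → α), st j = q ∧ st l ∈ T.accept ∧
    ∀ i < l, j ≤ i → st (i + 1) ∈ T.step (st i) (x i, y i) ∧ y i ∈ D i

variable {T l D}

theorem Fwd.extend {j : ℕ} {e : Edge α QT} (h : Fwd T D j e.1)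
    (he : e.2.2.2 ∈ T.step e.1 (e.2.1, e.2.2.1)) (hy : e.2.2.1 ∈ D j) :
    Fwd T D (j + 1) e.2.2.2 := by
  obtain ⟨st, x, y, h0, h1, h2⟩ := h
  refine ⟨fun i => if i ≤ j then st i else e.2.2.2, fun i => if i < j then x i else e.2.1,
    fun i => if i < j then y i else e.2.2.1, by simpa using h0, by simp, fun i hi => ?_⟩
  rcases Nat.lt_succ_iff_lt_or_eq.1 hi with h' | rfl
  · simpa [h', h'.le, Nat.succ_le_of_lt h'] using h2 i h'
  · simpa [h1] using ⟨he, hy⟩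

theorem Bwd.extend {j : ℕ} {e : Edge α QT} (h : Bwd T l D (j + 1) e.2.2.2) (hj : j < l)
    (he : e.2.2.2 ∈ T.step e.1 (e.2.1, e.2.2.1)) (hy : e.2.2.1 ∈ D j) :
    Bwd T l D j e.1 := by
  obtain ⟨st, x, y, h1, h0, h2⟩ := h
  refine ⟨fun i => if i ≤ j then e.1 else st i, fun i => if i ≤ j then e.2.1 else x i,
    fun i => if i ≤ j then e.2.2.1 else y i, by simp, by simpa [hj.not_ge] using h0, fun i hi hji => ?_⟩
  rcases hji.eq_or_lt with rfl | h'
  · simpa [h1] using ⟨he, hy⟩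
  · simpa [not_le.2 h', not_le.2 (Nat.lt_succ_of_lt h')] using h2 i hi h'

/-- The forward run, the edge and the backward run concatenate to an accepting run with output
letters in `D`; closure of `D` then applies to its input letter at `j`. -/
theorem Fwd.glue {j : ℕ} {e : Edge α QT} (hf : Fwd T D j e.1) (hb : Bwd T l D (j + 1) e.2.2.2)
    (hj : j < l) (he : e.2.2.2 ∈ T.step e.1 (e.2.1, e.2.2.1)) (hy : e.2.2.1 ∈ D j)
    (hD : ∀ r : Run T l, (∀ j < l, r.y j ∈ D j) → ∀ j < l, r.x j ∈ D j) : e.2.1 ∈ D j := by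
  obtain ⟨st, x, y, h0, h1, h2⟩ := hf
  obtain ⟨st', x', y', h1', h0', h2'⟩ := hb
  have key : ∀ i < l, (if i + 1 ≤ j then st (i + 1) else st' (i + 1)) ∈
      T.step (if i ≤ j then st i else st' i) (if i < j then x i else if i = j then e.2.1 else x' i,
        if i < j then y i else if i = j then e.2.2.1 else y' i) ∧
      (if i < j then y i else if i = j then e.2.2.1 else y' i) ∈ D i := by
    intro i hi
    rcases lt_trichotomy i j with h | rfl | h
    · simpa [h, h.le, Nat.succ_le_of_lt h] using h2 i h
    · simpa [h1, h1'] using ⟨he, hy⟩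
    · simpa [h.ne', not_lt.2 h.le, not_le.2 h, not_le.2 (Nat.lt_succ_of_lt h)] using h2' i hi h
  simpa using hD ⟨fun i => if i ≤ j then st i else st' i, _, _, by simpa using h0,
    by simpa [hj.not_ge] using h0', fun i hi => (key i hi).1⟩ (fun i hi => (key i hi).2) j hj

variable (T l D) in
/-- An edge at position `j` whose ends lie on runs that read output letters in `D`, and whose
input letter is in `D`. -/
def Good (j : ℕ) (e : Edge α QT) : Prop :=
  Fwd T D j e.1 ∧ Bwd T l D j e.1 ∧ Fwd T D (j + 1) e.2.2.2 ∧ Bwd T l D (j + 1) e.2.2.2 ∧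
    e.2.1 ∈ D j

theorem Firing.all_or_first {s s' : List (Option QT)} {a : α} {L : List (Edge α QT)}
    (h : Firing T s s' a L) (P : Edge α QT → Prop) :
    (∀ e ∈ L, P e) ∨ ∃ e M, Usable T s s' a M e ∧ (∀ f ∈ M, P f) ∧ ¬ P e := by
  induction h with
  | nil => simp
  | @cons e L _ h ih =>
    rcases ih with ih | ih
    · by_cases he : P e
      · exact .inl (by simpa [he] using ih)
      · exact .inr ⟨e, L, h, ih, he⟩
    · exact .inr ih

variable {s : ℕ → List (Option QT)} {L : ℕ → List (Edge α QT)} {w : ℕ → α}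

/-- Columns are treated from left to right. In each, the first bad edge is considered: its source is
forward reachable, by `h0` or because the previous column is good and covers the boundary. `stuck`
then rules it out. -/
theorem Firing.all_good (hL : ∀ j < l, Firing T (s j) (s (j + 1)) (w j) (L j))
    (hcov : ∀ j < l, Covers (s j) (s (j + 1)) (L j))
    (h0 : ∀ p, some p ∈ s 0 → p ∈ T.start) (hl : ∀ p, some p ∈ s l → p ∈ T.accept)
    (hw : ∀ j < l, w j ∈ D j)
    (hD : ∀ r : Run T l, (∀ j < l, r.y j ∈ D j) → ∀ j < l, r.x j ∈ D j) :
    ∀ j < l, ∀ e ∈ L j, Good T l D j e := by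
  have hy : ∀ {j e M}, j < l → Usable T (s j) (s (j + 1)) (w j) M e →
      (∀ f ∈ M, Good T l D j f) → e.2.2.1 ∈ D j := by
    rintro j e M hj ⟨-, h | ⟨f, hf, h⟩, -⟩ hM
    · exact h ▸ hw j hj
    · exact h ▸ (hM f hf).2.2.2.2
  -- Only backward reachability of the target is missing. It is sought in the next column, by
  -- induction on the number `n` of columns to the right.
  have stuck : ∀ n j e M, j + n + 1 = l → Usable T (s j) (s (j + 1)) (w j) M e →
      (∀ f ∈ M, Good T l D j f) → Fwd T D j e.1 → Good T l D j e := by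
    intro n
    induction n with
    | zero =>
      intro j e M hj he hM hF
      have hjl : j < l := by omega
      have hye := hy hjl he hM
      -- The target sits at the last boundary, so it is accepting; the letters are dummies.
      have hB : Bwd T l D (j + 1) e.2.2.2 :=
        ⟨fun _ => e.2.2.2, fun _ => e.2.1, fun _ => e.2.1, rfl,
          hl _ (by simpa [← hj] using he.2.2.2.mem), fun i _ _ => by omega⟩
      exact ⟨hF, hB.extend hjl he.1 hye, hF.extend he.1 hye, hB, hF.glue hB hjl he.1 hye hD⟩
    | succ n ih =>
      intro j e M hj he hM hF
      have hjl : j < l := by omega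
      have hye := hy hjl he hM
      suffices hB : Bwd T l D (j + 1) e.2.2.2 from
        ⟨hF, hB.extend hjl he.1 hye, hF.extend he.1 hye, hB, hF.glue hB hjl he.1 hye hD⟩
      have hjl' : j + 1 < l := by omega
      rcases (hL _ hjl').all_or_first (Good T l D (j + 1)) with h | ⟨e', M', he', hM', hn⟩
      · obtain ⟨f, hf, h'⟩ := (hcov _ hjl').1 _ he.2.2.2.mem
        exact h' ▸ (h f hf).2.1
      · rcases he.2.2.2.compare he'.2.2.1 with h | ⟨f, hf, h⟩ | ⟨f, hf, h⟩
        · exact absurd (ih (j + 1) e' M' (by omega) he' hM' (h ▸ hF.extend he.1 hye)) hn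
        · exact h ▸ (hM' f hf).2.1
        · exact absurd (ih (j + 1) e' M' (by omega) he' hM' (h ▸ (hM f hf).2.2.1)) hn
  intro j
  induction j with
  | zero =>
    intro hj
    rcases (hL _ hj).all_or_first (Good T l D 0) with h | ⟨e, M, he, hM, hn⟩
    · exact h
    · exact absurd (stuck (l - 1) 0 e M (by omega) he hM ⟨fun _ => e.1, fun _ => e.2.1,
        fun _ => e.2.1, h0 _ he.2.2.1.mem, rfl, fun i hi => by omega⟩) hn
  | succ j ih =>
    intro hj
    rcases (hL _ hj).all_or_first (Good T l D (j + 1)) with h | ⟨e, M, he, hM, hn⟩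
    · exact h
    · obtain ⟨f, hf, h'⟩ := (hcov j (by omega)).2 _ he.2.2.1.mem
      exact absurd (stuck (l - (j + 2)) (j + 1) e M (by omega) he hM
        (h' ▸ (ih (by omega) f hf).2.2.1)) hn

end Soundness

/-- The empty clause of length `w.length` is inductive because transitions preserve length; `w`
violates it, and a word of any other length satisfies it. -/
theorem RTS.PotReach.length_eq {R : RTS α QI QT} {u w : List α} (h : R.PotReach 1 u w) :
    u.length = w.length := by
  by_contra hne
  have := h w.length [∅] (by simp) (fun v v' hv hs => ?_) (.inl hne)
  · simp [Formula.Sat] at this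
  · obtain ⟨x, -, rfl, rfl⟩ := hv
    simpa [Formula.Sat] using hs

theorem nil_mem_Ind_iff (R : RTS α QI QT) : [] ∈ R.Ind 1 ↔ [] ∈ R.initial.accepts := by
  constructor
  · rintro ⟨u, hu, h⟩
    rwa [← List.length_eq_zero_iff.1 h.length_eq]
  · exact fun h => ⟨[], h, fun l φ _ _ h => h⟩

theorem nil_mem_sepNFA_iff [Fintype QT] (R : RTS α QI QT) :
    [] ∈ (sepNFA R).accepts ↔ [] ∈ R.initial.accepts := by
  rw [nil_mem_accepts_iff, nil_mem_accepts_iff]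
  constructor
  · rintro ⟨q, hq, hq'⟩
    exact ⟨_, hq.2, hq'.2⟩
  · rintro ⟨q, hq, hq'⟩
    exact ⟨(fun _ => none, (∅, ∅), false, q), ⟨by simp, hq⟩,
      by simp, hq'⟩

theorem sepNFA_sound [Fintype QT] (R : RTS α QI QT) (w : ℕ → α) (l : ℕ)
    (h : (List.range l).map w ∈ (sepNFA R).accepts) : (List.range l).map w ∈ R.Ind 1 := by
  obtain ⟨τ, h0, hl, hstep⟩ := (mem_accepts_iff _ _ _).1 h
  have : ∀ j, ∃ (L : List (Edge α QT)) (x : α), j < l →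
      Firing R.transducer (List.ofFn (τ j).1) (List.ofFn (τ (j + 1)).1) (w j) L ∧
      Covers (List.ofFn (τ j).1) (List.ofFn (τ (j + 1)).1) L ∧ Produced (w j) L x ∧
      (τ (j + 1)).2.2.2 ∈ R.initial.step (τ j).2.2.2 x := by
    intro j
    by_cases hj : j < l
    · obtain ⟨L, h1, h2, x, h3, h4⟩ := hstep j hj
      exact ⟨L, x, fun _ => ⟨h1, h2, h3, h4⟩⟩
    · exact ⟨[], w j, fun h => absurd h hj⟩
  choose L x hLx using this
  refine ⟨(List.range l).map x, (mem_accepts_iff _ _ _).2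
    ⟨fun j => (τ j).2.2.2, h0.2, hl.2, fun j hj => (hLx j hj).2.2.2⟩, ?_⟩
  intro l' φ hφ hind hsat
  by_cases hll : l = l'
  swap
  · exact .inl (by simpa using hll)
  subst hll
  match φ, hφ with
  | [], _ => exact .inr (by simp)
  | [c], _ =>
    by_contra hw
    rw [sat_singleton_iff] at hw hsat
    push Not at hw
    -- Past the end of the word there is no restriction. Closure of `D` is the contrapositive of
    -- inductiveness of `c`.
    let D : ℕ → Set α := fun j => {b | ∀ hj : j < l, (b, ⟨j, hj⟩) ∉ c}
    have key := Firing.all_good (T := R.transducer) (D := D) (l := l)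
      (fun j hj => (hLx j hj).1) (fun j hj => (hLx j hj).2.1) h0.1 hl.1
      (fun j _ hj' hc => hw _ hc rfl) (fun r hr => ?_)
    · obtain ⟨p, hp, hx⟩ := hsat
      have hpD : x p.2 ∈ D p.2 := by
        rcases (hLx p.2 p.2.2).2.2.1 with h | ⟨f, hf, h⟩
        · exact fun hj' hc => hw _ hc h.symm
        · exact h ▸ (key p.2 p.2.2 f hf).2.2.2.2
      exact hpD p.2.2 (by rw [hx]; exact hp)
    · intro j hj hj' hc
      have := hind _ _ r.trans ((sat_singleton_iff _ _).2 ⟨_, hc, rfl⟩)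
      obtain ⟨p, hp, hy⟩ := (sat_singleton_iff _ _).1 this
      exact hr p.2 p.2.2 p.2.2 (by rw [hy]; exact hp)

/-! ### Completeness -/

section Completeness

variable {T : NFA (α × α) QT} {l : ℕ}

/-- Lists of runs (latest first), each of which reads output letters that are letters of `w` or
input letters of earlier runs. -/
inductive Derivation (w : ℕ → α) : List (Run T l) → Prop
  | nil : Derivation w []
  | cons {r : Run T l} {Λ : List (Run T l)} : Derivation w Λ →
      (∀ j < l, r.y j = w j ∨ ∃ r' ∈ Λ, r'.x j = r.y j) → Derivation w (r :: Λ)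

/-- The derived letters form a subset of the finite set `Fin l × α`, so a derivation with a maximal
such subset exists; any further run it permits derives nothing new. -/
theorem exists_maximal_derivation [Finite α] (w : ℕ → α) : ∃ Λ : List (Run T l), Derivation w Λ ∧
    ∀ r : Run T l, (∀ j < l, r.y j = w j ∨ ∃ r' ∈ Λ, r'.x j = r.y j) →
      ∀ j < l, r.x j = w j ∨ ∃ r' ∈ Λ, r'.x j = r.x j := by
  let S : List (Run T l) → Set (Fin l × α) := fun Λ =>
    {p | p.2 = w p.1 ∨ ∃ r ∈ Λ, r.x p.1 = p.2}
  obtain ⟨M, ⟨Λ, hΛ, rfl⟩, hmax⟩ :=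
    (Set.toFinite (S '' {Λ | Derivation w Λ})).exists_maximal ⟨_, [], .nil, rfl⟩
  refine ⟨Λ, hΛ, fun r hr j hj => ?_⟩
  have := hmax (y := S (r :: Λ)) ⟨_, hΛ.cons hr, rfl⟩ (by
    rintro p (h | ⟨r', h, h'⟩)
    · exact .inl h
    · exact .inr ⟨r', by simp [h], h'⟩)
  exact this (show ((⟨j, hj⟩ : Fin l), r.x j) ∈ S (r :: Λ) from .inr ⟨r, by simp, rfl⟩)

/-- The states of the runs at boundary `j`, without repetitions, in the order of their first
visits from right to left, padded to length `n`. -/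
noncomputable def visited (n j : ℕ) (Λ : List (Run T l)) : List (Option QT) :=
  open Classical in
  let d := (Λ.map fun r => r.st j).dedup
  d.map some ++ List.replicate (n - d.length) none

theorem length_visited [Fintype QT] (j : ℕ) (Λ : List (Run T l)) :
    (visited (Fintype.card QT) j Λ).length = Fintype.card QT := by
  classical
  have := (List.nodup_dedup (Λ.map fun r => r.st j)).length_le_card
  simp only [visited, List.length_append, List.length_map, List.length_replicate]
  convert Nat.add_sub_cancel' this

theorem some_mem_visited {n j : ℕ} {Λ : List (Run T l)} {p : QT} :
    some p ∈ visited n j Λ ↔ ∃ r ∈ Λ, r.st j = p := by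
  simp [visited]

/-- `dedup` keeps last occurrences. As runs are listed latest first, these are first visits, and
whatever follows `q` was visited earlier. -/
theorem exists_dedup_eq {Q : Type*} [DecidableEq Q] (P M : List Q) (q : Q) :
    ∃ A B, (P ++ q :: M).dedup = A ++ q :: B ∧ ∀ p ∈ B, p ∈ M := by
  induction P with
  | nil =>
    by_cases h : q ∈ M
    · obtain ⟨A, B, e⟩ := List.append_of_mem (List.mem_dedup.2 h)
      refine ⟨A, B, by simpa [h] using e, fun p hp => ?_⟩
      rw [← List.mem_dedup, e]
      simp [hp]
    · exact ⟨[], M.dedup, by simp [h], fun p => by simp⟩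
  | cons a P ih =>
    obtain ⟨A, B, e, h⟩ := ih
    by_cases ha : a ∈ P ++ q :: M
    · exact ⟨A, B, by rw [List.cons_append, List.dedup_cons_of_mem ha, e], h⟩
    · exact ⟨a :: A, B, by rw [List.cons_append, List.dedup_cons_of_notMem ha, e]; rfl, h⟩

theorem ready_visited (n j : ℕ) (P M : List (Run T l)) (r : Run T l) :
    Ready (visited n j (P ++ r :: M)) {p | ∃ r' ∈ M, r'.st j = p} (r.st j) := by
  classical
  obtain ⟨A, B, e, h⟩ :=
    exists_dedup_eq (P.map fun r => r.st j) (M.map fun r => r.st j) (r.st j)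
  refine ⟨A.map some, B.map some ++ List.replicate (n - (A ++ r.st j :: B).length) none, ?_,
    fun p hp => ?_⟩
  · simp only [visited, List.map_append, List.map_cons]
    rw [e]
    simp
  · simpa using h p (by simpa using hp)

/-- The edge of a run at position `j`. -/
def Run.edge (j : ℕ) (r : Run T l) : Edge α QT := (r.st j, r.x j, r.y j, r.st (j + 1))

/-- In every column the edges fire in the order of the runs: a state first visited before the
current run is an endpoint of an earlier run's edge. -/
theorem Derivation.firing {w : ℕ → α} {Λ : List (Run T l)} (h : Derivation w Λ) {j : ℕ}
    (hj : j < l) (n : ℕ) :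
    Firing T (visited n j Λ) (visited n (j + 1) Λ) (w j) (Λ.map (Run.edge j)) := by
  suffices H : ∀ M : List (Run T l), Derivation w M → ∀ P, Λ = P ++ M →
      Firing T (visited n j Λ) (visited n (j + 1) Λ) (w j) (M.map (Run.edge j)) from
    H Λ h [] rfl
  intro M hM
  induction hM with
  | nil => exact fun _ _ => .nil
  | @cons r M _ hr ih =>
    intro P hP
    refine .cons (ih (P ++ [r]) (by simp [hP])) ⟨r.step j hj, ?_, ?_, ?_⟩
    · rcases hr j hj with h | ⟨r', h, h'⟩
      · exact .inl h
      · exact .inr ⟨_, List.mem_map_of_mem h, h'⟩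
    · simpa [Run.edge, hP] using ready_visited n j P M r
    · simpa [Run.edge, hP] using ready_visited n (j + 1) P M r

end Completeness

theorem sepNFA_complete [Finite α] [Fintype QT] (R : RTS α QI QT) (w : ℕ → α) (l : ℕ)
    (h : (List.range l).map w ∈ R.Ind 1) : (List.range l).map w ∈ (sepNFA R).accepts := by
  classical
  have := Fintype.ofFinite α
  have : Nonempty α := ⟨w 0⟩
  obtain ⟨u, hu, hpot⟩ := h
  have hlen : u.length = l := by simpa using hpot.length_eq
  obtain ⟨x, hx⟩ := exists_eq_map_range u
  rw [hlen] at hx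
  subst hx
  obtain ⟨τ, h0, hl, hstep⟩ := (mem_accepts_iff _ _ _).1 hu
  obtain ⟨Λ, hΛ, hmax⟩ := exists_maximal_derivation (T := R.transducer) (l := l) w
  have hprod : ∀ j < l, x j = w j ∨ ∃ r ∈ Λ, r.x j = x j := by
    -- The clause of all underived letters. It is false at `w`, and an underived letter of the
    -- initial word would make it true there.
    let c : Clause α l := Finset.univ.filter fun p => ¬ (p.1 = w p.2 ∨ ∃ r ∈ Λ, r.x p.2 = p.1)
    by_contra hn
    push Not at hn
    obtain ⟨j, hj, h1, h2⟩ := hn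
    have := hpot l [c] le_rfl (fun v v' hv hs => ?_)
      ((sat_singleton_iff _ _).2 ⟨(x j, ⟨j, hj⟩), by simpa [c] using ⟨h1, h2⟩, rfl⟩)
    · obtain ⟨p, hp, e⟩ := (sat_singleton_iff _ _).1 this
      simp [c, e] at hp
    · by_cases hvl : v.length = l
      swap
      · obtain ⟨r, h3, h4⟩ := hv.exists_run rfl
        exact .inl (by rw [h4]; simpa using hvl)
      obtain ⟨r, h3, h4⟩ := hv.exists_run hvl
      -- If the output word violates `c`, its letters are all derived; by maximality so are the
      -- input letters, and the input word violates `c` too.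
      by_contra hs'
      rw [h4, sat_singleton_iff] at hs'
      rw [h3, sat_singleton_iff] at hs
      obtain ⟨p, hp, e⟩ := hs
      have := hmax r (fun j hj => ?_) p.2 p.2.2
      · rw [e] at this
        simp only [c, Finset.mem_filter, Finset.mem_univ, true_and] at hp
        exact hp this
      · by_contra hn
        exact hs' ⟨(r.y j, ⟨j, hj⟩), by simpa [c] using hn, rfl⟩
  have hs : ∀ j, ∃ f : Fin (Fintype.card QT) → Option QT,
      List.ofFn f = visited (Fintype.card QT) j Λ := by
    intro j
    refine ⟨fun i => (visited (Fintype.card QT) j Λ)[i]'(by rw [length_visited]; exact i.2), ?_⟩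
    exact List.ext_getElem (by simp [length_visited]) fun i _ _ => by simp
  choose s hs using hs
  refine (mem_accepts_iff _ _ _).2 ⟨fun j => (s j, (∅, ∅), false, τ j), ⟨?_, h0⟩, ⟨?_, hl⟩, ?_⟩
  · intro p hp
    obtain ⟨r, -, rfl⟩ := some_mem_visited.1 (hs 0 ▸ hp)
    exact r.start
  · intro p hp
    obtain ⟨r, -, rfl⟩ := some_mem_visited.1 (hs l ▸ hp)
    exact r.accept
  · intro j hj
    simp only [sepNFA, Set.mem_ofPred_eq, hs]
    refine ⟨Λ.map (Run.edge j), hΛ.firing hj _, ⟨fun p hp => ?_, fun p hp => ?_⟩, x j, ?_,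
      hstep j hj⟩
    · obtain ⟨r, hr, h⟩ := some_mem_visited.1 hp
      exact ⟨_, List.mem_map_of_mem hr, h⟩
    · obtain ⟨r, hr, h⟩ := some_mem_visited.1 hp
      exact ⟨_, List.mem_map_of_mem hr, h⟩
    · rcases hprod j hj with h | ⟨r, hr, h⟩
      · exact .inl h
      · exact .inr ⟨_, List.mem_map_of_mem hr, h⟩

theorem sepNFA_accepts [Finite α] [Fintype QT] (R : RTS α QI QT) :
    (sepNFA R).accepts = R.Ind 1 := by
  ext w
  -- The alphabet may be empty, so the empty word is treated apart; any other word supplies a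
  -- default letter.
  rcases w.eq_nil_or_concat with rfl | ⟨v, a, -⟩
  · rw [nil_mem_sepNFA_iff, nil_mem_Ind_iff]
  · have : Nonempty α := ⟨a⟩
    obtain ⟨x, hx⟩ := exists_eq_map_range w
    rw [hx]
    exact ⟨sepNFA_sound R x _, sepNFA_complete R x _⟩

end RegularMC

namespace RegularMC

variable {α QI QT : Type*}

/-! ### Saturation -/

section Saturation

variable {T : NFA (α × α) QT} {s s' : List (Option QT)} {a : α} {L M : List (Edge α QT)}

theorem Produced.mono {x : α} (h : Produced a L x) (hLM : L ⊆ M) : Produced a M x :=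
  h.imp_right fun ⟨f, hf, e⟩ => ⟨f, hLM hf, e⟩

theorem Ready.mono {Q : Type*} {l : List (Option Q)} {F G : Set Q} {q : Q} (h : Ready l F q)
    (hFG : F ⊆ G) : Ready l G q := by
  obtain ⟨A, B, e, h⟩ := h
  exact ⟨A, B, e, fun p hp => hFG (h p hp)⟩

theorem Usable.mono {e : Edge α QT} (h : Usable T s s' a L e) (hLM : L ⊆ M) :
    Usable T s s' a M e :=
  ⟨h.1, h.2.1.mono hLM, h.2.2.1.mono fun _ ⟨f, hf, e⟩ => ⟨f, hLM hf, e⟩,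
    h.2.2.2.mono fun _ ⟨f, hf, e⟩ => ⟨f, hLM hf, e⟩⟩

variable (T s s' a) in
open Classical in
/-- Adds an edge if it is usable. -/
noncomputable def addUsable (L : List (Edge α QT)) (e : Edge α QT) : List (Edge α QT) :=
  if Usable T s s' a L e then e :: L else L

variable (T s s' a) in
/-- Goes through the edges in `E` once, and adds those that are usable. -/
noncomputable def addAll (E L : List (Edge α QT)) : List (Edge α QT) :=
  E.foldl (addUsable T s s' a) L

variable (T s s' a) in
/-- Goes through the edges in `E` as many times as there are edges. -/
noncomputable def saturation (E : List (Edge α QT)) : List (Edge α QT) :=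
  E.foldl (fun L _ => addAll T s s' a E L) []

theorem subset_addUsable (e : Edge α QT) : L ⊆ addUsable T s s' a L e := by
  unfold addUsable
  split_ifs <;> simp

theorem subset_addAll (E : List (Edge α QT)) : L ⊆ addAll T s s' a E L := by
  induction E generalizing L with
  | nil => exact fun _ h => h
  | cons e E ih => exact fun _ h => ih (subset_addUsable e h)

theorem mem_addAll {E : List (Edge α QT)} {e : Edge α QT} (he : e ∈ E)
    (hu : Usable T s s' a L e) : e ∈ addAll T s s' a E L := by
  induction E generalizing L with
  | nil => simp at he
  | cons e' E ih =>
    rcases List.mem_cons.1 he with rfl | he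
    · exact subset_addAll E (by simp [addUsable, hu])
    · exact ih he (hu.mono (subset_addUsable e'))

theorem addAll_induction {P : List (Edge α QT) → Prop} (E : List (Edge α QT))
    (hP : ∀ L, ∀ e ∈ E, P L → Usable T s s' a L e → P (e :: L)) (h : P L) :
    P (addAll T s s' a E L) := by
  induction E generalizing L with
  | nil => exact h
  | cons e E ih =>
    refine ih (fun L e' he' => hP L e' (by simp [he'])) ?_
    unfold addUsable
    split_ifs with hu
    · exact hP L e (by simp) h hu
    · exact h

theorem saturation_eq (E : List (Edge α QT)) :
    saturation T s s' a E = (addAll T s s' a E)^[E.length] [] := by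
  rw [saturation, List.foldl_const]

theorem firing_saturation (E : List (Edge α QT)) : Firing T s s' a (saturation T s s' a E) := by
  rw [saturation_eq]
  generalize E.length = n
  induction n with
  | zero => exact .nil
  | succ n ih =>
    rw [Function.iterate_succ_apply']
    exact addAll_induction E (fun L e _ h hu => .cons h hu) ih

/-- A round that starts from an unsaturated list adds a new edge, so `E.length` rounds suffice.
Edges may be added repeatedly, so distinct ones are counted. -/
theorem mem_saturation {E : List (Edge α QT)} (hE : ∀ L e, Usable T s s' a L e → e ∈ E)
    {e : Edge α QT} (hu : Usable T s s' a (saturation T s s' a E) e) :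
    e ∈ saturation T s s' a E := by
  classical
  have sub : ∀ L, Firing T s s' a L → L ⊆ E := by
    intro L hL
    induction hL with
    | nil => simp
    | cons _ h ih => exact List.cons_subset.2 ⟨hE _ _ h, ih⟩
  have key : ∀ n : ℕ, (∀ e, Usable T s s' a ((addAll T s s' a E)^[n] []) e →
      e ∈ (addAll T s s' a E)^[n] []) ∨ n ≤ ((addAll T s s' a E)^[n] []).toFinset.card := by
    intro n
    induction n with
    | zero => exact .inr (Nat.zero_le _)
    | succ n ih =>
      rw [Function.iterate_succ_apply']
      generalize (addAll T s s' a E)^[n] [] = L at ih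
      by_cases hc : ∀ e, Usable T s s' a L e → e ∈ L
      · left
        have : addAll T s s' a E L ⊆ L := addAll_induction (P := fun M => M ⊆ L) E
          (fun M e _ h hu => List.cons_subset.2 ⟨hc e (hu.mono h), h⟩) (List.Subset.refl L)
        exact fun e hu => subset_addAll E (hc e (hu.mono this))
      · right
        have hn := ih.resolve_left hc
        push Not at hc
        obtain ⟨e, hu, he⟩ := hc
        refine Nat.succ_le_of_lt (hn.trans_lt (Finset.card_lt_card ?_))
        refine Finset.ssubset_iff_of_subset (fun f hf => ?_) |>.2
          ⟨e, by simpa using mem_addAll (hE _ _ hu) hu, by simpa using he⟩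
        simpa using subset_addAll E (by simpa using hf)
  rcases key E.length with h | h <;> rw [← saturation_eq] at h
  · exact h e hu
  · have : (saturation T s s' a E).toFinset = E.toFinset :=
      Finset.eq_of_subset_of_card_le (fun f hf => List.mem_toFinset.2
        (sub _ (firing_saturation E) (List.mem_toFinset.1 hf))) ((List.toFinset_card_le E).trans h)
    rw [← List.mem_toFinset, this, List.mem_toFinset]
    exact hE _ _ hu

theorem Firing.subset_saturation {E : List (Edge α QT)}
    (hE : ∀ L e, Usable T s s' a L e → e ∈ E) (h : Firing T s s' a L) :
    L ⊆ saturation T s s' a E := by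
  induction h with
  | nil => simp
  | cons _ hu ih => exact List.cons_subset.2 ⟨mem_saturation hE (hu.mono ih), ih⟩

theorem Covers.mono (h : Covers s s' L) (hLM : L ⊆ M) : Covers s s' M :=
  ⟨fun p hp => let ⟨f, hf, e⟩ := h.1 p hp; ⟨f, hLM hf, e⟩,
    fun p hp => let ⟨f, hf, e⟩ := h.2 p hp; ⟨f, hLM hf, e⟩⟩

end Saturation

/-- The saturation is itself a firing and contains every other one, and `Covers` and `Produced` are
monotone; so it is the only list that needs testing. -/
theorem mem_step_sepNFA_iff [Fintype QT] (R : RTS α QI QT) (q q' : SepState QI QT) (a : α)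
    {E : List (Edge α QT)} (hE : ∀ e : Edge α QT,
      e.2.2.2 ∈ R.transducer.step e.1 (e.2.1, e.2.2.1) → e ∈ E) :
    q' ∈ (sepNFA R).step q a ↔
      Covers (List.ofFn q.1) (List.ofFn q'.1)
        (saturation R.transducer (List.ofFn q.1) (List.ofFn q'.1) a E) ∧
      ∃ x, Produced a (saturation R.transducer (List.ofFn q.1) (List.ofFn q'.1) a E) x ∧
        q'.2.2.2 ∈ R.initial.step q.2.2.2 x := by
  constructor
  · rintro ⟨L, hL, hc, x, hx, h⟩
    have := hL.subset_saturation fun L e hu => hE e hu.1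
    exact ⟨hc.mono this, x, hx.mono this, h⟩
  · rintro ⟨hc, x, hx, h⟩
    exact ⟨_, firing_saturation E, hc, x, hx, h⟩

/-! ### The algorithm on trees -/

namespace Data

theorem fold_size_add {g : Data → Data} {c : Data}
    (hg : ∀ x a, (g (cons c (cons x a))).size ≤ a.size + x.size + 1) (l a : Data) :
    (fold g c l a).size ≤ a.size + l.size := by
  induction l generalizing a with
  | nil => simp [fold, toList]
  | cons x r _ ih =>
    have h1 := ih (g (cons c (cons x a)))
    have h2 := hg x a
    have h4 : fold g c (cons x r) a = fold g c r (g (cons c (cons x a))) := rfl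
    rw [h4]
    simp only [size]
    omega

theorem size_hd_le (d : Data) : d.hd.size ≤ d.size := by
  cases d <;> simp [size]
  omega

theorem size_tl_le (d : Data) : d.tl.size ≤ d.size := by
  cases d <;> simp [size]
  omega

/-- Equality of numbers in unary. -/
def Eqv (x y : Data) : Prop := x.toList.length = y.toList.length

/-- Some element `f` of the list `L` has `f.hd` equal to `p`. -/
def Source (L p : Data) : Prop := ∃ f ∈ L.toList, f.hd.Eqv p

def Target (L p : Data) : Prop := ∃ f ∈ L.toList, f.tl.tl.tl.hd.Eqv p

/-- The counterpart of `RegularMC.Produced`. -/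
def Produced (a L x : Data) : Prop := x.Eqv a ∨ ∃ f ∈ L.toList, f.tl.hd.Eqv x

/-- The counterpart of `RegularMC.Ready`. -/
def Ready (s : Data) (F : Data → Prop) (q : Data) : Prop :=
  ∃ A o B, s.toList = A ++ o :: B ∧ (o ≠ nil ∧ o.hd.Eqv q) ∧ ∀ o ∈ B, o = nil ∨ F o.hd

/-- The counterpart of `RegularMC.Usable`. -/
def Usable (s s' a L e : Data) : Prop :=
  Produced a L e.tl.tl.hd ∧ Ready s (Source L) e.hd ∧ Ready s' (Target L) e.tl.tl.tl.hd

/-- The transitions of the initial automaton in an encoded input. -/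
def initialEdges (d : Data) : Data := d.hd.tl.hd.tl.tl.tl.hd

/-- The transitions of the transducer in an encoded input. -/
def edges (d : Data) : Data := d.hd.tl.tl.hd.tl.tl.tl.hd

/-- The lists of states of the transducer, and the letter, in an encoded input. -/
def fst (d : Data) : Data := d.tl.hd.hd

def letter (d : Data) : Data := d.tl.tl.hd

def snd (d : Data) : Data := d.tl.tl.tl.hd.hd

open Classical in
/-- The counterpart of `RegularMC.addUsable`, for `z` made of an input, an edge and a list. -/
noncomputable def addUsable (z : Data) : Data :=
  if Usable z.hd.hd.fst z.hd.hd.snd z.hd.hd.letter z.tl.tl z.tl.hd then z.tl else z.tl.tl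

/-- The counterpart of `RegularMC.addAll`. -/
noncomputable def addAll (z : Data) : Data := fold addUsable z z.hd.edges z.tl.tl

/-- The counterpart of `RegularMC.saturation`. -/
noncomputable def saturation (d : Data) : Data := fold addAll d d.edges nil

/-- The condition for a transition of the automaton, for an input and a list of edges. -/
def Step (d L : Data) : Prop :=
  ((∀ o ∈ d.fst.toList, o = nil ∨ Source L o.hd) ∧ ∀ o ∈ d.snd.toList, o = nil ∨ Target L o.hd) ∧
    ∃ t ∈ d.initialEdges.toList, Produced d.letter L t.tl.hd ∧
      t.hd.Eqv d.tl.hd.tl.tl.tl.tl.hd ∧ t.tl.tl.hd.Eqv d.tl.tl.tl.hd.tl.tl.tl.tl.hd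

end Data

/-! ### Polynomial-time bounds for the algorithm on trees. -/

section Complexity

variable {a e f L s s' x : Data → Data}

theorem PolyDec.eq_nil (hf : PolyTime f) : PolyDec fun d => f d = Data.nil := by
  simpa using (PolyDec.ne_nil hf).not

theorem PolyTime.lift (hf : PolyTime f) : PolyTime fun d => f d.hd := hf.comp (.hd .id)

theorem polyDec_source (hL : PolyTime L) (hx : PolyTime x) :
    PolyDec fun d => Data.Source (L d) (x d) :=
  PolyDec.ex (P := fun d => d.tl.hd.Eqv (x d.hd)) (.length_eq (.hd (.tl .id)) hx.lift) hL

theorem polyDec_target (hL : PolyTime L) (hx : PolyTime x) :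
    PolyDec fun d => Data.Target (L d) (x d) :=
  PolyDec.ex (P := fun d => d.tl.tl.tl.tl.hd.Eqv (x d.hd))
    (.length_eq (.hd (.tl (.tl (.tl (.tl .id))))) hx.lift) hL

theorem polyDec_produced (ha : PolyTime a) (hL : PolyTime L) (hx : PolyTime x) :
    PolyDec fun d => Data.Produced (a d) (L d) (x d) :=
  .or (.length_eq hx ha) (.ex (P := fun d => d.tl.tl.hd.Eqv (x d.hd))
    (.length_eq (.hd (.tl (.tl .id))) hx.lift) hL)

theorem polyDec_ready (hs : PolyTime s) {F : Data → Data → Prop}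
    (hF : PolyDec fun d => F d.hd d.tl.hd) (hx : PolyTime x) :
    PolyDec fun d => Data.Ready (s d) (F d) (x d) :=
  PolyDec.since (P := fun d => d.tl ≠ .nil ∧ d.tl.hd.Eqv (x d.hd))
    (Q := fun d => d.tl = .nil ∨ F d.hd d.tl.hd)
    (.and (.ne_nil (.tl .id)) (.length_eq (.hd (.tl .id)) hx.lift)) (.or (.eq_nil (.tl .id)) hF) hs

theorem polyDec_usable (hs : PolyTime s) (hs' : PolyTime s') (ha : PolyTime a) (hL : PolyTime L)
    (he : PolyTime e) : PolyDec fun d => Data.Usable (s d) (s' d) (a d) (L d) (e d) :=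
  .and (polyDec_produced ha hL he.tl.tl.hd) <| .and
    (polyDec_ready (F := fun d => Data.Source (L d)) hs (polyDec_source hL.lift (.hd (.tl .id)))
      he.hd)
    (polyDec_ready (F := fun d => Data.Target (L d)) hs' (polyDec_target hL.lift (.hd (.tl .id)))
      he.tl.tl.tl.hd)

theorem polyTime_edges : PolyTime Data.edges := PolyTime.id.hd.tl.tl.hd.tl.tl.tl.hd

theorem polyTime_fst : PolyTime Data.fst := PolyTime.id.tl.hd.hd

theorem polyTime_snd : PolyTime Data.snd := PolyTime.id.tl.tl.tl.hd.hd

theorem polyTime_letter : PolyTime Data.letter := PolyTime.id.tl.tl.hd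

open Classical in
theorem polyTime_addUsable : PolyTime Data.addUsable :=
  PolyDec.ite (polyDec_usable polyTime_fst.lift.lift polyTime_snd.lift.lift polyTime_letter.lift.lift
    PolyTime.id.tl.tl PolyTime.id.tl.hd) PolyTime.id.tl PolyTime.id.tl.tl

theorem size_addUsable_le (c x a : Data) :
    (Data.addUsable (.cons c (.cons x a))).size ≤ a.size + x.size + 1 := by
  unfold Data.addUsable
  split_ifs <;> simp [Data.size] <;> omega

theorem polyTime_addAll : PolyTime Data.addAll :=
  polyTime_addUsable.fold (Polynomial.X + Polynomial.C 1)
    (fun c x a => (size_addUsable_le c x a).trans (by simp [add_assoc, add_comm])) polyTime_edges.lift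
    PolyTime.id.tl.tl

/-- One pass adds at most the whole edge list, a subtree of `c`. The bound on the growth is thus
free of `a`, as the outer fold requires. -/
theorem size_addAll_le (c x a : Data) :
    (Data.addAll (.cons c (.cons x a))).size ≤ a.size + c.size := by
  refine (Data.fold_size_add (size_addUsable_le _) _ _).trans (Nat.add_le_add_left ?_ _)
  exact (Data.size_hd_le _).trans <| (Data.size_tl_le _).trans <| (Data.size_tl_le _).trans <|
    (Data.size_tl_le _).trans <| (Data.size_hd_le _).trans <| (Data.size_tl_le _).trans <|
    (Data.size_tl_le _).trans <| Data.size_hd_le c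

theorem polyTime_saturation : PolyTime Data.saturation :=
  polyTime_addAll.fold Polynomial.X
    (fun c x a => (size_addAll_le c x a).trans (by simp)) polyTime_edges .nil

theorem polyDec_step : PolyDec fun d => d.Step d.saturation := by
  have hL := polyTime_saturation
  refine .and (.and ?_ ?_) ?_
  · exact .all (P := fun z => z.tl = .nil ∨ Data.Source z.hd.saturation z.tl.hd)
      (.or (.eq_nil (.tl .id)) (polyDec_source hL.lift PolyTime.id.tl.hd)) polyTime_fst
  · exact .all (P := fun z => z.tl = .nil ∨ Data.Target z.hd.saturation z.tl.hd)
      (.or (.eq_nil (.tl .id)) (polyDec_target hL.lift PolyTime.id.tl.hd)) polyTime_snd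
  · exact .ex (P := fun z => Data.Produced z.hd.letter z.hd.saturation z.tl.tl.hd ∧
      z.tl.hd.Eqv z.hd.tl.hd.tl.tl.tl.tl.hd ∧ z.tl.tl.tl.hd.Eqv z.hd.tl.tl.tl.hd.tl.tl.tl.tl.hd)
      (.and (polyDec_produced polyTime_letter.lift hL.lift PolyTime.id.tl.tl.hd)
        (.and (.length_eq PolyTime.id.tl.hd PolyTime.id.hd.tl.hd.tl.tl.tl.tl.hd)
          (.length_eq PolyTime.id.tl.tl.tl.hd PolyTime.id.hd.tl.tl.tl.hd.tl.tl.tl.tl.hd)))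
      PolyTime.id.hd.tl.hd.tl.tl.tl.hd

theorem PolyDec.exists_prog {P : Data → Prop} (hP : PolyDec P) :
    ∃ (M : Prog) (p : Polynomial ℕ), ∀ d, AnswersWithin M d (p.eval d.size) (P d) := by
  obtain ⟨f, ⟨p, -, hc⟩, hf⟩ := hP
  obtain ⟨M, hM⟩ := hc 0
  refine ⟨M, p, fun d => ?_⟩
  obtain ⟨s', t, h1, h2, h3, -⟩ := hM (inputStore d)
  exact ⟨s', t, h1, h2, by rw [h3]; exact (hf d).2⟩

end Complexity

/-! ### The algorithm on encoded inputs -/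

section Encoding

variable {k m n : ℕ} (eα : α ≃ Fin k) (eI : QI ≃ Fin m) (eT : QT ≃ Fin n)

/-- The encoding of an edge. -/
def encEdge (e : Edge α QT) : Data :=
  .ofList [encElem eT e.1, encElem eα e.2.1, encElem eα e.2.2.1, encElem eT e.2.2.2]

/-- The encoding of an optional state. -/
def encOption (o : Option QT) : Data := .ofOption (o.map (encElem eT))

theorem eqv_encElem {β : Type*} {n : ℕ} (e : β ≃ Fin n) (x y : β) :
    (encElem e x).Eqv (encElem e y) ↔ x = y := by
  have : ∀ n, (Data.ofNat n).toList.length = n := by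
    intro n
    induction n with
    | zero => rfl
    | succ n ih => simp [Data.ofNat, Data.toList, ih]
  rw [Data.Eqv, encElem, encElem, this, this, Fin.val_inj, e.apply_eq_iff_eq]

variable {eα eT} in
theorem source_iff (L : List (Edge α QT)) (p : QT) :
    Data.Source (.ofList (L.map (encEdge eα eT))) (encElem eT p) ↔ ∃ f ∈ L, f.1 = p := by
  simp only [Data.Source, Data.toList_ofList, List.mem_map, exists_exists_and_eq_and]
  exact exists_congr fun f => and_congr_right fun _ => eqv_encElem eT _ _

variable {eα eT} in
theorem target_iff (L : List (Edge α QT)) (p : QT) :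
    Data.Target (.ofList (L.map (encEdge eα eT))) (encElem eT p) ↔ ∃ f ∈ L, f.2.2.2 = p := by
  simp only [Data.Target, Data.toList_ofList, List.mem_map, exists_exists_and_eq_and]
  exact exists_congr fun f => and_congr_right fun _ => eqv_encElem eT _ _

variable {eα eT} in
theorem produced_iff (a : α) (L : List (Edge α QT)) (x : α) :
    Data.Produced (encElem eα a) (.ofList (L.map (encEdge eα eT))) (encElem eα x) ↔
      Produced a L x := by
  simp only [Data.Produced, Data.toList_ofList, List.mem_map, exists_exists_and_eq_and]
  exact or_congr (eqv_encElem eα _ _)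
    (exists_congr fun f => and_congr_right fun _ => eqv_encElem eα _ _)

variable {eT} in
theorem ready_iff (l : List (Option QT)) {F : Data → Prop} {G : Set QT}
    (hF : ∀ p, F (encElem eT p) ↔ p ∈ G) (q : QT) :
    Data.Ready (.ofList (l.map (encOption eT))) F (encElem eT q) ↔ Ready l G q := by
  simp only [Data.Ready, Data.toList_ofList]
  constructor
  · rintro ⟨A, o, B, e, ⟨ho, hq⟩, hB⟩
    obtain ⟨A, l', rfl, rfl, h⟩ := List.map_eq_append_iff.1 e
    obtain ⟨o, B, rfl, rfl, rfl⟩ := List.map_eq_cons_iff.1 h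
    cases o with
    | none => exact absurd rfl ho
    | some p =>
      obtain rfl := (eqv_encElem eT p q).1 hq
      exact ⟨A, B, rfl, fun p' hp' => (hF p').1
        ((hB _ (List.mem_map_of_mem hp')).resolve_left (fun h => nomatch h))⟩
  · rintro ⟨A, B, rfl, hB⟩
    refine ⟨A.map (encOption eT), encOption eT (some q), B.map (encOption eT), by simp,
      ⟨(fun h => nomatch h), (eqv_encElem eT q q).2 rfl⟩, fun o ho => ?_⟩
    obtain ⟨_ | p, hp, rfl⟩ := List.mem_map.1 ho
    · exact .inl rfl
    · exact .inr ((hF p).2 (hB p hp))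

variable {eα eT} in
-- The tree version omits the test that `e` is a transition, since only encoded transitions are ever
-- offered to it; hence `he`.
theorem usable_iff (T : NFA (α × α) QT) (s s' : List (Option QT)) (a : α) (L : List (Edge α QT))
    {e : Edge α QT} (he : e.2.2.2 ∈ T.step e.1 (e.2.1, e.2.2.1)) :
    Data.Usable (.ofList (s.map (encOption eT))) (.ofList (s'.map (encOption eT))) (encElem eα a)
      (.ofList (L.map (encEdge eα eT))) (encEdge eα eT e) ↔ Usable T s s' a L e :=
  (and_congr (produced_iff a L _) (and_congr (ready_iff s (source_iff L) _)
    (ready_iff s' (target_iff L) _))).trans ⟨fun h => ⟨he, h⟩, fun h => h.2⟩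

open Classical in
/-- The edges of a transducer, in the order of the encoding. -/
noncomputable def edgeList (T : NFA (α × α) QT) : List (Edge α QT) :=
  (((List.finRange n).map eT.symm) ×ˢ ((List.finRange k).map eα.symm) ×ˢ
    ((List.finRange k).map eα.symm) ×ˢ ((List.finRange n).map eT.symm)).filter
      (fun x => decide (x.2.2.2 ∈ T.step x.1 (x.2.1, x.2.2.1)))

theorem mem_edgeList (T : NFA (α × α) QT) (e : Edge α QT) :
    e ∈ edgeList eα eT T ↔ e.2.2.2 ∈ T.step e.1 (e.2.1, e.2.2.1) := by
  obtain ⟨q, x, y, q'⟩ := e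
  simp only [edgeList, List.mem_filter, List.mem_product, List.mem_map, List.mem_finRange, true_and,
    decide_eq_true_eq, and_iff_right_iff_imp]
  exact fun _ => ⟨⟨eT q, by simp⟩, ⟨eα x, by simp⟩, ⟨eα y, by simp⟩, ⟨eT q', by simp⟩⟩

variable [Fintype QT] (R : RTS α QI QT) (q q' : SepState QI QT) (a : α)

theorem edges_encInput : (encInput eα eI eT R q a q').edges =
    .ofList ((edgeList eα eT R.transducer).map (encEdge eα eT)) := rfl

theorem fst_encInput : (encInput eα eI eT R q a q').fst =
    .ofList ((List.ofFn q.1).map (encOption eT)) := by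
  rw [List.map_ofFn]; rfl

theorem snd_encInput : (encInput eα eI eT R q a q').snd =
    .ofList ((List.ofFn q'.1).map (encOption eT)) := by
  rw [List.map_ofFn]; rfl

theorem letter_encInput : (encInput eα eI eT R q a q').letter = encElem eα a := rfl

theorem initialEdges_encInput (t : Data) :
    t ∈ (encInput eα eI eT R q a q').initialEdges.toList ↔ ∃ p x p',
      p' ∈ R.initial.step p x ∧ t = .ofList [encElem eI p, encElem eα x, encElem eI p'] := by
  classical
  have : (encInput eα eI eT R q a q').initialEdges = Data.ofList
      (((((List.finRange m).map eI.symm) ×ˢ ((List.finRange k).map eα.symm) ×ˢ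
          ((List.finRange m).map eI.symm)).filter
        (fun x => decide (x.2.2 ∈ R.initial.step x.1 x.2.1))).map
        (fun x => Data.ofList [encElem eI x.1, encElem eα x.2.1, encElem eI x.2.2])) := by
    simp only [encInput, encRTS, encNFA, Data.initialEdges, Data.ofList, Data.hd_cons, Data.tl_cons]
  rw [this, Data.toList_ofList, List.mem_map]
  constructor
  · rintro ⟨⟨p, x, p'⟩, h, rfl⟩
    exact ⟨p, x, p', by simpa using (List.mem_filter.1 h).2, rfl⟩
  · rintro ⟨p, x, p', h, rfl⟩
    refine ⟨(p, x, p'), List.mem_filter.2 ⟨?_, by simpa using h⟩, rfl⟩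
    simp only [List.mem_product, List.mem_map, List.mem_finRange, true_and]
    exact ⟨⟨eI p, by simp⟩, ⟨eα x, by simp⟩, ⟨eI p', by simp⟩⟩

theorem saturation_encInput : (encInput eα eI eT R q a q').saturation =
    .ofList ((saturation R.transducer (List.ofFn q.1) (List.ofFn q'.1) a
      (edgeList eα eT R.transducer)).map (encEdge eα eT)) := by
  -- The context of a pass also holds a counter element and the list at the start of the pass; only
  -- its head, the input, is read.
  have inner : ∀ (c : Data), c.hd = encInput eα eI eT R q a q' → ∀ E L : List (Edge α QT),
      E ⊆ edgeList eα eT R.transducer → Data.fold Data.addUsable c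
        (.ofList (E.map (encEdge eα eT))) (.ofList (L.map (encEdge eα eT))) =
      .ofList ((addAll R.transducer (List.ofFn q.1) (List.ofFn q'.1) a E L).map
        (encEdge eα eT)) := by
    intro c hc E
    induction E with
    | nil => exact fun _ _ => rfl
    | cons e E ih =>
      intro L hE
      rw [List.cons_subset] at hE
      have he := usable_iff (eα := eα) (eT := eT) R.transducer (List.ofFn q.1) (List.ofFn q'.1) a L
        ((mem_edgeList eα eT _ e).1 hE.1)
      have hadd : Data.addUsable (.cons c (.cons (encEdge eα eT e)
          (.ofList (L.map (encEdge eα eT))))) = .ofList ((addUsable R.transducer (List.ofFn q.1)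
            (List.ofFn q'.1) a L e).map (encEdge eα eT)) := by
        rw [← fst_encInput eα eI eT R q q' a, ← snd_encInput eα eI eT R q q' a,
          ← letter_encInput eα eI eT R q q' a, ← hc] at he
        by_cases hu : Usable R.transducer (List.ofFn q.1) (List.ofFn q'.1) a L e
        · refine (if_pos (he.2 hu)).trans ?_
          rw [addUsable, if_pos hu]
          rfl
        · refine (if_neg (mt he.1 hu)).trans ?_
          rw [addUsable, if_neg hu]
          rfl
      have := ih (addUsable R.transducer (List.ofFn q.1) (List.ofFn q'.1) a L e) hE.2
      rw [← hadd] at this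
      exact this
  -- Here `E` serves only as a counter of rounds; each pass runs through the full edge list.
  have outer : ∀ E L : List (Edge α QT), Data.fold Data.addAll (encInput eα eI eT R q a q')
      (.ofList (E.map (encEdge eα eT))) (.ofList (L.map (encEdge eα eT))) =
      .ofList ((E.foldl (fun L _ => addAll R.transducer (List.ofFn q.1) (List.ofFn q'.1) a
        (edgeList eα eT R.transducer) L) L).map (encEdge eα eT)) := by
    intro E
    induction E with
    | nil => exact fun _ => rfl
    | cons e E ih =>
      intro L
      have := ih (addAll R.transducer (List.ofFn q.1) (List.ofFn q'.1) a
        (edgeList eα eT R.transducer) L)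
      rw [← inner (.cons (encInput eα eI eT R q a q') (.cons (encEdge eα eT e)
        (.ofList (L.map (encEdge eα eT))))) rfl _ _ (List.Subset.refl _),
        ← edges_encInput eα eI eT R q q' a] at this
      exact this
  exact outer (edgeList eα eT R.transducer) []

theorem step_encInput_iff :
    (encInput eα eI eT R q a q').Step (encInput eα eI eT R q a q').saturation ↔
      q' ∈ (sepNFA R).step q a := by
  rw [mem_step_sepNFA_iff R q q' a (fun e he => (mem_edgeList eα eT R.transducer e).2 he),
    saturation_encInput]
  generalize saturation R.transducer (List.ofFn q.1) (List.ofFn q'.1) a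
    (edgeList eα eT R.transducer) = L
  have cov : ∀ (l : List (Option QT)) (F : Data → Prop) (G : QT → Prop),
      (∀ p, F (encElem eT p) ↔ G p) →
      ((∀ o ∈ (Data.ofList (l.map (encOption eT))).toList, o = Data.nil ∨ F o.hd) ↔
        ∀ p, some p ∈ l → G p) := by
    intro l F G h
    rw [Data.toList_ofList]
    constructor
    · exact fun H p hp => (h p).1
        ((H _ (List.mem_map_of_mem hp)).resolve_left (fun h => nomatch h))
    · intro H o ho
      obtain ⟨_ | p, hp, rfl⟩ := List.mem_map.1 ho
      · exact .inl rfl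
      · exact .inr ((h p).2 (H p hp))
  unfold Data.Step
  rw [fst_encInput, snd_encInput, letter_encInput, cov _ _ _ (source_iff L),
    cov _ _ _ (target_iff L)]
  refine and_congr Iff.rfl ?_
  simp only [initialEdges_encInput]
  have h1 : (encInput eα eI eT R q a q').tl.hd.tl.tl.tl.tl.hd = encElem eI q.2.2.2 := rfl
  have h2 : (encInput eα eI eT R q a q').tl.tl.tl.hd.tl.tl.tl.tl.hd = encElem eI q'.2.2.2 := rfl
  rw [h1, h2]
  constructor
  · rintro ⟨t, ⟨p, x, p', h, rfl⟩, hx, hp, hp'⟩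
    obtain rfl := (eqv_encElem eI _ _).1 hp
    obtain rfl := (eqv_encElem eI _ _).1 hp'
    exact ⟨x, (produced_iff a L x).1 hx, h⟩
  · rintro ⟨x, hx, h⟩
    exact ⟨_, ⟨_, x, _, h, rfl⟩, (produced_iff a L x).2 hx, (eqv_encElem eI _ _).2 rfl,
      (eqv_encElem eI _ _).2 rfl⟩

end Encoding

/-! ### The number of states. -/

theorem card_sepState [Fintype QI] [Fintype QT] : Fintype.card (SepState QI QT) =
    (Fintype.card QT + 1) ^ Fintype.card QT *
      (2 ^ Fintype.card QT * 2 ^ Fintype.card QT) * 2 * Fintype.card QI := by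
  classical
  simp only [SepState, Fintype.card_prod, Fintype.card_fun, Fintype.card_option, Fintype.card_fin,
    Fintype.card_finset, Fintype.card_bool]
  ring

theorem card_sepState_le [Fintype QI] [Fintype QT] : Fintype.card (SepState QI QT) ≤
    2 ^ ((Fintype.card QT + 1) ^ 2 + Fintype.card QI) := by
  rw [card_sepState]
  generalize Fintype.card QT = n
  generalize Fintype.card QI = m
  -- Uses `n + 1 ≤ 2 ^ n` and `m ≤ 2 ^ m`; the exponents add up to `n ^ 2 + 2 * n + 1 + m`.
  calc (n + 1) ^ n * (2 ^ n * 2 ^ n) * 2 * m ≤ (2 ^ n) ^ n * (2 ^ n * 2 ^ n) * 2 * 2 ^ m := by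
        gcongr
        · exact Nat.lt_two_pow_self
        · exact Nat.lt_two_pow_self.le
    _ = 2 ^ ((n + 1) ^ 2 + m) := by
        rw [← pow_mul]
        ring

end RegularMC

theorem mainTheorem4 :
    ∃ (M : RegularMC.Prog) (p : Polynomial ℕ),
      ∀ (α QI QT : Type*) [Fintype α] [Fintype QI] [Fintype QT] (R : RegularMC.RTS α QI QT),
        (∃ A : NFA α (RegularMC.SepState QI QT),
          A.accepts = R.Ind 1 ∧
          ∀ (eα : α ≃ Fin (Fintype.card α)) (eI : QI ≃ Fin (Fintype.card QI))
            (eT : QT ≃ Fin (Fintype.card QT))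
            (q : RegularMC.SepState QI QT) (a : α) (q' : RegularMC.SepState QI QT),
            RegularMC.AnswersWithin M (RegularMC.encInput eα eI eT R q a q')
              (p.eval (RegularMC.encInput eα eI eT R q a q').size) (q' ∈ A.step q a)) ∧
        Fintype.card (RegularMC.SepState QI QT) =
          (Fintype.card QT + 1) ^ Fintype.card QT *
            (2 ^ Fintype.card QT * 2 ^ Fintype.card QT) * 2 * Fintype.card QI ∧
        Fintype.card (RegularMC.SepState QI QT) ≤
          2 ^ ((Fintype.card QT + 1) ^ 2 + Fintype.card QI) := by
  obtain ⟨M, p, h⟩ := RegularMC.polyDec_step.exists_prog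
  refine ⟨M, p, fun α QI QT _ _ _ R => ⟨⟨RegularMC.sepNFA R, RegularMC.sepNFA_accepts R,
    fun eα eI eT q a q' => ?_⟩, RegularMC.card_sepState, RegularMC.card_sepState_le⟩⟩
  rw [← RegularMC.step_encInput_iff eα eI eT R q q' a]
  exact h _
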